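/- Let $G=(V,E,F)$ be a finite bipartite graph, parallel edges allowed, embedded in a closed oriented surface (not necessarily connected) so that the faces are open disks and all vertices have degree at least $3$. Colour $V=V^+\sqcup V^-$, orient each edge $e$ from $V^-$ to $V^+$, and write $e^*=(g,g')$ if $g$ is the face on the left and $g'$ the face on the right of $e$. A circle pattern $z$ assigns to each vertex a point of $\hat{\mathbb C}=\mathbb C\cup\{\infty\}$ and to each face $g$ a circle or line of $\hat{\mathbb C}$ with center $z^*(g)$ (the reflection of $\infty$, so $\infty$ for a line), such that the vertices of each face lie on its circle, adjacent vertices have distinct images and adjacent faces have distinct centers. Its star-ratio at $g$ is $$-\prod_{e^*=(g',g)}\bigl(z^*(g')-z^*(g)\bigr)\Big/\prod_{e^*=(g,g')}\bigl(z^*(g')-z^*(g)\bigr),$$ where infinite factors of numerator and denominator cancel. The pattern is Kasteleyn if all its star-ratios are real and positive. Let $z$ be a Kasteleyn circle pattern on $G$; more generally it suffices that the star-ratios are real and positive at all faces of some set $S\ni f$ and that the centers of the faces outside $S$ are finite. Let $f$ be a valid face: a face of degree $4$ with exactly four neighbours $f_1,f_2,f_3,f_4$ (in cyclic order) such that $z^*(f_k)\ne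 z^*(f_{k+1})$ for all $k$ (indices mod $4$). Assume that $z^*(f),z^*(f_1),\dots,z^*(f_4)$ do not lie on a common line. Let $v_k$ be the corner of $f$ between $f_k$ and $f_{k+1}$, and $c_k$ the circle of $f_k$. The 4-mutation $\tilde G$ of $G$ at $f$ is obtained as follows. Each corner $v_k$ of degree $3$ is deleted together with its edge not on $f$, and the other end of that edge becomes the new corner of $f$; each other corner $v_k$ is replaced, as a corner of $f$, by a new vertex that is joined by a new edge, between $f_k$ and $f_{k+1}$, to $v_k$. The faces stay the same. The Miquel move at $f$ replaces the circle of $f$ by the circle $\tilde c$ through the second intersection points $\tilde I_k$, where $c_k\cap c_{k+1}=\{z(v_k),\tilde I_k\}$, and the corners of $f$ by the $\tilde I_k$; all else is unchanged. (Here $\tilde c\cap c_{k+1}=\{\tilde I_k,\tilde I_{k+1}\}$ for all $k$; if all $\tilde I_k$ coincide, $\tilde c$ may be the circle of radius $0$ at that point.) Give each edge of $G$ the weight $\omega(e)=|z^*(g)-z^*(g')|$, $e^*=(g,g')$, and let $\tilde\omega$ be the weights on $\tilde G$ defined likewise from the circle centers after the move. Then the Miquel move exists, $\omega$ and $\tilde\omega$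 are finite and positive, and they are related by urban renewal. That is, let $N_f$ be the set of edges incident to no other faces than $f,f_1,\dots,f_4$, and identify the edges outside $N_f$ in $G$ and in $\tilde G$. Then $\omega(e)=\tilde\omega(e)$ for all $e\notin N_f$, and for every perfect matching $M_0$ of $G$ $$\sum_{M}P_\omega(M)=\sum_{\tilde M}P_{\tilde\omega}(\tilde M),$$ where $M$ and $\tilde M$ run over the perfect matchings of $G$ and of $\tilde G$ that agree with $M_0$ outside $N_f$, and $P_\omega(M)=\prod_{e\in M}\omega(e)\big/\sum_{M'}\prod_{e\in M'}\omega(e)$ with $M'$ running over all perfect matchings of $G$ (and likewise $P_{\tilde\omega}$ for $\tilde G$). -/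

import Mathlib

open scoped BigOperators OnePoint

/-! ### Bipartite graphs on closed oriented surfaces

A bipartite graph embedded in a closed oriented surface with disk faces is encoded by its rotation
system. Colours are booleans: `true` stands for `V⁺` (black), `false` for `V⁻` (white). Only the
labels in `verts` and `edges` belong to the graph; every label in `F` is a face. Parallel edges are
allowed. -/

/-- Combinatorial data of a bipartite graph on an oriented surface. Edges are oriented from their
white to their black end; `left x`, `right x` are the faces on the two sides of `x`, so that the
dual edge is `x* = (left x, right x)`. `next c x` is the edge following `x` in counterclockwise
order around the end of `x` of colour `c`. -/
structure BipartiteMap (V E F : Type*) where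
  verts : Set V
  edges : Set E
  endpt : Bool → E → V
  left : E → F
  right : E → F
  next : Bool → E → E

namespace BipartiteMap

variable {V E F : Type*}

/-- Number of edges at a vertex. -/
noncomputable def degree (G : BipartiteMap V E F) (v : V) : ℕ :=
  Set.ncard {x | x ∈ G.edges ∧ ∃ c, G.endpt c x = v}

/-- The data describe a (finite, if `E` is finite) bipartite graph in a closed oriented surface,
all complementary components being disks, with all vertices of degree at least three.
The surface need not be connected. Going counterclockwise along the boundary of a face, the edges
having the face on their left are visited (backwards) by the map `next true ∘ next false`; between
two of them there is one edge having the face on its right. So each face has even degree `≥ 2`. -/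
structure IsSurfaceGraph (G : BipartiteMap V E F) : Prop where
  next_mem : ∀ c, ∀ x ∈ G.edges, G.next c x ∈ G.edges
  endpt_eq_iff : ∀ c, ∀ x ∈ G.edges, ∀ y ∈ G.edges,
    (G.endpt c x = G.endpt c y ↔ ∃ n : ℕ, (G.next c)^[n] x = y)
  right_next : ∀ x ∈ G.edges, G.right (G.next false x) = G.left x
  left_eq_iff : ∀ x ∈ G.edges, ∀ y ∈ G.edges,
    (G.left x = G.left y ↔ ∃ n : ℕ, (G.next true ∘ G.next false)^[n] x = y)
  exists_left_eq : ∀ g : F, ∃ x ∈ G.edges, G.left x = g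
  bipartite : ∀ x ∈ G.edges, ∀ y ∈ G.edges, G.endpt true x ≠ G.endpt false y
  mem_verts_iff : ∀ v, v ∈ G.verts ↔ ∃ c, ∃ x ∈ G.edges, G.endpt c x = v
  three_le_degree : ∀ v ∈ G.verts, 3 ≤ G.degree v

/-! ### Dimers -/

/-- Each vertex is incident to exactly one edge of `M`. -/
def IsPerfectMatching (G : BipartiteMap V E F) (M : Finset E) : Prop :=
  (∀ x ∈ M, x ∈ G.edges) ∧ ∀ v ∈ G.verts, ∃! x, x ∈ M ∧ ∃ c, G.endpt c x = v

open Classical in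
/-- The dimer partition function. -/
noncomputable def partitionFunction [Fintype E] (G : BipartiteMap V E F) (ω : E → ℝ) : ℝ :=
  ∑ M : Finset E with G.IsPerfectMatching M, ∏ x ∈ M, ω x

/-- The probability of a perfect matching `M` for the edge weights `ω`. -/
noncomputable def dimerProb [Fintype E] (G : BipartiteMap V E F) (ω : E → ℝ) (M : Finset E) : ℝ :=
  (∏ x ∈ M, ω x) / G.partitionFunction ω

/-! ### Quadrilaterals and mutation

A quadrilateral `f` is given with its boundary edges `e 0, e 1, e 2, e 3` in counterclockwise
order, starting with an edge having `f` on its left. The corner number `k` lies between `e k` and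
`e (k + 1)`; it is black for even `k` and white for odd `k`. -/

/-- Colour of the `k`-th corner of a quadrilateral. -/
def cornerColor (k : Fin 4) : Bool := decide (k.val % 2 = 0)

/-- `f` is a face of degree four with boundary edges `e 0, e 1, e 2, e 3` in counterclockwise
order. -/
structure IsQuadrilateral (G : BipartiteMap V E F) (f : F) (e : Fin 4 → E) : Prop where
  mem : ∀ k, e k ∈ G.edges
  left_zero : G.left (e 0) = f
  next_eq : ∀ k, G.next (cornerColor k) (e (k + 1)) = e k
  zero_ne_two : e 0 ≠ e 2

/-- The face across the edge `e k`. -/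
def nbr (G : BipartiteMap V E F) (e : Fin 4 → E) (k : Fin 4) : F :=
  if cornerColor k then G.right (e k) else G.left (e k)

/-- The `k`-th corner, which is a vertex of `f`, of `nbr k` and of `nbr (k + 1)`. -/
def corner (G : BipartiteMap V E F) (e : Fin 4 → E) (k : Fin 4) : V :=
  G.endpt (cornerColor k) (e k)

/-- The edge following `e (k + 1)` and `e k` counterclockwise around the `k`-th corner. If the
corner has degree three, this is its only edge that is not an edge of `f`. -/
def leg (G : BipartiteMap V E F) (e : Fin 4 → E) (k : Fin 4) : E :=
  G.next (cornerColor k) (e k)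

/-- The other end of `leg k`. -/
def farEnd (G : BipartiteMap V E F) (e : Fin 4 → E) (k : Fin 4) : V :=
  G.endpt (!cornerColor k) (G.leg e k)

/-- The corner disappears in the mutation, and so does its leg. -/
def Contracts (G : BipartiteMap V E F) (e : Fin 4 → E) (k : Fin 4) : Prop :=
  G.degree (G.corner e k) = 3

open Classical in
/-- The `k`-th corner of `f` after mutation, which has the colour opposite to `cornerColor k`: the
far end of the leg if the old corner is contracted, and a new vertex otherwise. -/
noncomputable def newCorner (G : BipartiteMap V E F) (e : Fin 4 → E) (k : Fin 4) : V ⊕ Fin 4 :=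
  if G.Contracts e k then Sum.inl (G.farEnd e k) else Sum.inr k

open Classical in
/-- `g k` if `x` is the edge `e k`, and `d` if `x` is none of the four edges. -/
noncomputable def onBoundary {α : Type*} (e : Fin 4 → E) (g : Fin 4 → α) (d : α) (x : E) : α :=
  if x = e 0 then g 0 else if x = e 1 then g 1 else if x = e 2 then g 2 else
    if x = e 3 then g 3 else d

open Classical in
/-- Around an old vertex of colour `c`, the mutation replaces the leg of a contracted corner `j` of
the other colour by the two edges `e (j + 1)`, `e j`, and it replaces the two edges
`e (k + 1)`, `e k` at a corner `k` of colour `c` by the new leg of that corner. `entry G e c x` is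
the first of the edges that replace `x` in the counterclockwise order. -/
noncomputable def entry (G : BipartiteMap V E F) (e : Fin 4 → E) (c : Bool) (x : E) : E ⊕ Fin 4 :=
  if h : ∃ j, cornerColor j ≠ c ∧ G.Contracts e j ∧ x = G.leg e j then
    Sum.inl (e (h.choose + 1))
  else if h : ∃ k, cornerColor k = c ∧ x = e (k + 1) then Sum.inr h.choose
  else Sum.inl x

open Classical in
/-- The 4-mutation of `G` at the quadrilateral with boundary edges `e`. The faces stay the same.
Each of the four edges of the quadrilateral keeps its label, now has the quadrilateral on its other
side and joins the new corners. A corner of degree three is deleted together with its leg, whose far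
end becomes the new corner. Any other corner `k` is detached from the quadrilateral and joined by a
new edge `Sum.inr k` (the new leg, between the faces `nbr k` and `nbr (k + 1)`) to a new
vertex `Sum.inr k`. On the dual graph this adds the dual edges
`(nbr 1, nbr 0), (nbr 1, nbr 2), (nbr 3, nbr 2), (nbr 3, nbr 0)`, cancelling each of them
against an existing opposite one at a corner of degree three, and reverses the dual edges at the
quadrilateral. -/
noncomputable def mutation (G : BipartiteMap V E F) (e : Fin 4 → E) :
    BipartiteMap (V ⊕ Fin 4) (E ⊕ Fin 4) F where
  verts := {w | (∃ v ∈ G.verts, (∀ k, G.Contracts e k → v ≠ G.corner e k) ∧ w = Sum.inl v) ∨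
    ∃ k, ¬ G.Contracts e k ∧ w = Sum.inr k}
  edges := {y | (∃ x ∈ G.edges, (∀ k, G.Contracts e k → x ≠ G.leg e k) ∧ y = Sum.inl x) ∨
    ∃ k, ¬ G.Contracts e k ∧ y = Sum.inr k}
  endpt c := Sum.elim
    (fun x => onBoundary e
      (fun k => if cornerColor k = c then G.newCorner e (k - 1) else G.newCorner e k)
      (Sum.inl (G.endpt c x)) x)
    (fun k => if cornerColor k = c then Sum.inl (G.corner e k) else Sum.inr k)
  left := Sum.elim
    (fun x => onBoundary e (fun k => G.right (e k)) (G.left x) x)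
    (fun k => if cornerColor k then G.nbr e (k + 1) else G.nbr e k)
  right := Sum.elim
    (fun x => onBoundary e (fun k => G.left (e k)) (G.right x) x)
    (fun k => if cornerColor k then G.nbr e k else G.nbr e (k + 1))
  next c := Sum.elim
    (fun x => onBoundary e
      (fun k => if cornerColor k = c then Sum.inl (e (k - 1))
        else if G.Contracts e k then G.entry e c (G.next c (G.leg e k)) else Sum.inr k)
      (G.entry e c (G.next c x)) x)
    (fun k => if cornerColor k = c then G.entry e c (G.next c (e k)) else Sum.inl (e (k + 1)))

/-! ### Urban renewal -/

/-- The edge neighbourhood of a quadrilateral `f`: the edges that are incident with no other faces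
than `f` and its four neighbours. -/
def edgeNbhd (G : BipartiteMap V E F) (f : F) (e : Fin 4 → E) : Set E :=
  {x | x ∈ G.edges ∧ (G.left x = f ∨ ∃ k, G.left x = G.nbr e k) ∧
    (G.right x = f ∨ ∃ k, G.right x = G.nbr e k)}

open Classical in
/-- The edge weights `ω` of `G` and `ω'` of the mutated graph are related by urban renewal at `f`.
An edge `x` of `G` outside the edge neighbourhood of `f` is identified with the edge `Sum.inl x`
of the mutated graph. -/
def RelatedByUrbanRenewal [Fintype E] (G : BipartiteMap V E F) (f : F) (e : Fin 4 → E)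
    (ω : E → ℝ) (ω' : E ⊕ Fin 4 → ℝ) : Prop :=
  (∀ x ∈ G.edges, x ∉ G.edgeNbhd f e → ω x = ω' (Sum.inl x)) ∧
  ∀ M₀ : Finset E, G.IsPerfectMatching M₀ →
    (∑ M : Finset E with G.IsPerfectMatching M ∧
        ∀ x ∈ G.edges, x ∉ G.edgeNbhd f e → (x ∈ M ↔ x ∈ M₀), G.dimerProb ω M) =
      ∑ M : Finset (E ⊕ Fin 4) with (G.mutation e).IsPerfectMatching M ∧
        ∀ x ∈ G.edges, x ∉ G.edgeNbhd f e → (Sum.inl x ∈ M ↔ x ∈ M₀),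
          (G.mutation e).dimerProb ω' M

end BipartiteMap

/-! ### Circle patterns in the Riemann sphere -/

/-- `S` is a circle of the Riemann sphere (a Euclidean circle, or a line together with `∞`), and
`m` is its centre, the reflection of `∞` about the circle. -/
inductive IsCircle : Set (OnePoint ℂ) → OnePoint ℂ → Prop
  | circle (m : ℂ) (r : ℝ) (hr : 0 < r) :
      IsCircle ((fun p : ℂ => (p : OnePoint ℂ)) '' Metric.sphere m r) m
  | line (p d : ℂ) (hd : d ≠ 0) :
      IsCircle (insert ∞ (Set.range fun t : ℝ => ((p + t * d : ℂ) : OnePoint ℂ))) ∞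

/-- Positions of the vertices, and circles with their centres for the faces. -/
structure CircleDrawing (V F : Type*) where
  pos : V → OnePoint ℂ
  circ : F → Set (OnePoint ℂ)
  center : F → OnePoint ℂ

/-- The drawing is a circle pattern of `G`: the vertices of each face lie on the circle of the face,
adjacent vertices have distinct positions and adjacent faces have distinct centres. -/
structure IsCirclePattern {V E F : Type*} (G : BipartiteMap V E F) (z : CircleDrawing V F) :
    Prop where
  isCircle : ∀ g, IsCircle (z.circ g) (z.center g)
  pos_mem_left : ∀ x ∈ G.edges, ∀ c, z.pos (G.endpt c x) ∈ z.circ (G.left x)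
  pos_mem_right : ∀ x ∈ G.edges, ∀ c, z.pos (G.endpt c x) ∈ z.circ (G.right x)
  pos_ne : ∀ x ∈ G.edges, z.pos (G.endpt false x) ≠ z.pos (G.endpt true x)
  center_ne : ∀ x ∈ G.edges, z.center (G.left x) ≠ z.center (G.right x)

/-- The difference `q - p` if it is finite, and `1` otherwise. -/
noncomputable def finiteDiff : OnePoint ℂ → OnePoint ℂ → ℂ
  | OnePoint.some p, OnePoint.some q => q - p
  | _, _ => 1

open Classical in
/-- The star-ratio of `y : F → Ĉ` at `g`, that is
`- ∏_{(g', g) ∈ E*} (y g' - y g) / ∏_{(g, g') ∈ E*} (y g' - y g)`.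
An infinite factor of the numerator cancels an infinite factor of the denominator, and division by
zero gives infinity. (If adjacent faces have distinct images, then no factor is zero, and the
indeterminate forms `∞ - ∞`, `0 / 0` do not occur.) -/
noncomputable def starRatio {V E F : Type*} [Fintype E] (G : BipartiteMap V E F)
    (y : F → OnePoint ℂ) (g : F) : OnePoint ℂ :=
  let into : Finset E := {x : E | x ∈ G.edges ∧ G.right x = g}
  let out : Finset E := {x : E | x ∈ G.edges ∧ G.left x = g}
  let a : ℕ := (into.filter fun x => y g = ∞ ∨ y (G.left x) = ∞).card
  let b : ℕ := (out.filter fun x => y g = ∞ ∨ y (G.right x) = ∞).card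
  let num : ℂ := ∏ x ∈ into, finiteDiff (y g) (y (G.left x))
  let den : ℂ := ∏ x ∈ out, finiteDiff (y g) (y (G.right x))
  if b < a ∨ (a = b ∧ den = 0) then ∞
  else if a < b then ((0 : ℂ) : OnePoint ℂ)
  else ((-(num / den) : ℂ) : OnePoint ℂ)

/-- The star-ratios of the centres at all faces in `S` are real and positive. The circle pattern is
Kasteleyn if this holds for `S = Set.univ`. -/
def IsKasteleynOn {V E F : Type*} [Fintype E] (G : BipartiteMap V E F) (z : CircleDrawing V F)
    (S : Set F) : Prop :=
  ∀ g ∈ S, ∃ t : ℝ, 0 < t ∧ starRatio G z.center g = ((t : ℂ) : OnePoint ℂ)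

/-- Distance of two finite points (zero by convention if one of them is infinite). -/
noncomputable def finiteDist : OnePoint ℂ → OnePoint ℂ → ℝ
  | OnePoint.some p, OnePoint.some q => ‖p - q‖
  | _, _ => 0

/-- The weight of an edge: the distance of the centres of the two circles across it. -/
noncomputable def centerDistance {V V' E F : Type*} (G : BipartiteMap V E F)
    (z : CircleDrawing V' F) (x : E) : ℝ :=
  finiteDist (z.center (G.left x)) (z.center (G.right x))

/-- `f` is a valid face of the face drawing `y`: it has degree four and exactly four neighbours,
listed counterclockwise, and no two consecutive neighbours have the same image. -/
structure IsValidFace {V E F : Type*} (G : BipartiteMap V E F) (y : F → OnePoint ℂ) (f : F)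
    (e : Fin 4 → E) : Prop where
  quad : G.IsQuadrilateral f e
  nbr_injective : Function.Injective (G.nbr e)
  ne_succ : ∀ k, y (G.nbr e k) ≠ y (G.nbr e (k + 1))

/-- `z'` arises from `z` by the Miquel move at `f`. With `c_k` the circle of `nbr k`, the second
intersection point of `c_k` and `c_{k+1}` (equal to the first one if the circles touch) is
`z'.pos (Sum.inr k)`, and the circle of `f` is replaced by the circle through these four points.
It meets each `c_k` exactly in the two (possibly equal) new points on `c_k`, which makes it unique
even if the new points are not distinct; if all four coincide it is that point.
All other circles and vertices stay where they are. If the `k`-th corner is contracted in the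
mutation, then the new corner is the far end of the leg and already lies in the second intersection
point, and `Sum.inr k` is not a vertex of the mutated graph. -/
structure IsMiquelMove {V E F : Type*} (G : BipartiteMap V E F) (f : F) (e : Fin 4 → E)
    (z : CircleDrawing V F) (z' : CircleDrawing (V ⊕ Fin 4) F) : Prop where
  pos_old : ∀ v, z'.pos (Sum.inl v) = z.pos v
  circ_old : ∀ g, g ≠ f → z'.circ g = z.circ g
  center_old : ∀ g, g ≠ f → z'.center g = z.center g
  new_circle : IsCircle (z'.circ f) (z'.center f) ∨
    ∃ p : ℂ, z'.circ f = {(p : OnePoint ℂ)} ∧ z'.center f = p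
  inter_old : ∀ k, z.circ (G.nbr e k) ∩ z.circ (G.nbr e (k + 1)) =
    {z.pos (G.corner e k), z'.pos (Sum.inr k)}
  inter_new : ∀ k, z'.circ f ∩ z.circ (G.nbr e (k + 1)) =
    {z'.pos (Sum.inr k), z'.pos (Sum.inr (k + 1))}

/-!
Every star-ratio at a face with centre `∞` is `-1`, `0` or `∞`, never a positive
real, so all centres are finite. Write `m` for the centre of `f`, `y k` for those of its neighbours,
and `t > 0` for the star-ratio at `f`, so that `m` is a root of
`(X - y 1) (X - y 3) + t (X - y 0) (X - y 2)`. The second root `m'` (`mutatedCenter`) is the centre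
after the Miquel move: evaluating the factorised polynomial at `y k` gives
`(1 + t) (y k - m) (y k - m') = s (y k - y (k - 1)) (y k - y (k + 1))` with `s = 1` or `s = t`.

* Its argument modulo `π` says that the reflection about the line `y k, m'` is the composition of
  the reflections about the lines through `y k` and `y (k - 1)`, `m`, `y (k + 1)`, which carry each
  second intersection point to the next one (`IsMiquelConfig.secondPoint_succ`). So these points lie
  on a circle around `m'`. Conversely the centre of a circle that meets the outer circles in these
  points lies on all lines `y k, m'`. These lines do not all coincide, as otherwise `m` would be
  collinear with the `y k`, so the centre is `m'`. For the same reason a line cannot take the place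
  of the circle.
* Its absolute value is the transformation rule for the weights of the square
  (`IsMiquelConfig.norm_mutatedCenter_add_two`), where `t` is the quotient of the products of
  opposite distances.

For the dimers, a matching is split into edges away from the square, edges of the square, and legs,
which are forced: in `G` the leg of a contracted corner is used exactly if the square does not cover
this corner, and in the mutated graph the same holds for the new legs. Whether the outer edges can
be completed depends only on the set of corners covered from inside, and the covered corners of the old
square correspond to the uncovered corners of the new one (`isPerfectMatching_glueEdges`,
`mutation_isPerfectMatching_glueEdges`). This is insensitive to coincidences between corners
and far ends of legs. The identity `local_urban_renewal` between the weights of the square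
then shows that all partial partition functions change by the same factor, which cancels in the
probabilities.
-/

/-! ### Reflections and intersections of circles -/

open ComplexConjugate in
/-- The reflection of `v` about the line through `m` and `m'` (where `m ≠ m'`). -/
noncomputable def lineReflection (m m' v : ℂ) : ℂ :=
  m + (m' - m) / conj (m' - m) * conj (v - m)

section Reflection

open ComplexConjugate

theorem lineReflection_sub_mul {m m' : ℂ} (h : m ≠ m') (v : ℂ) :
    (lineReflection m m' v - m) * conj (m' - m) = (m' - m) * conj (v - m) := by
  have h1 : conj (m' - m) ≠ 0 := (map_ne_zero _).2 (sub_ne_zero.2 h.symm)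
  unfold lineReflection
  field_simp
  ring

theorem lineReflection_comm {m m' : ℂ} (h : m ≠ m') (v : ℂ) :
    lineReflection m m' v = lineReflection m' m v := by
  have h1 : conj (m' - m) ≠ 0 := (map_ne_zero _).2 (sub_ne_zero.2 h.symm)
  apply mul_right_cancel₀ h1
  have e1 := lineReflection_sub_mul h v
  have e2 := lineReflection_sub_mul h.symm v
  simp only [map_sub] at *
  linear_combination e1 + e2

theorem norm_lineReflection_sub_left {m m' : ℂ} (h : m ≠ m') (v : ℂ) :
    ‖lineReflection m m' v - m‖ = ‖v - m‖ := by
  have h1 : ‖m' - m‖ ≠ 0 := by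
    simpa [sub_eq_zero] using h.symm
  have e := congrArg norm (lineReflection_sub_mul h v)
  rw [norm_mul, norm_mul, Complex.norm_conj, Complex.norm_conj, mul_comm] at e
  exact mul_left_cancel₀ h1 e

theorem norm_lineReflection_sub_right {m m' : ℂ} (h : m ≠ m') (v : ℂ) :
    ‖lineReflection m m' v - m'‖ = ‖v - m'‖ := by
  rw [lineReflection_comm h, norm_lineReflection_sub_left h.symm]

theorem mul_conj_eq_of_norm_eq {a b : ℂ} (h : ‖a‖ = ‖b‖) : a * conj a = b * conj b := by
  rw [Complex.mul_conj, Complex.mul_conj, Complex.normSq_eq_norm_sq, Complex.normSq_eq_norm_sq, h]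

/-- Two points at equal distances from `m` and from `m'` coincide or are mirror images. -/
theorem eq_or_eq_lineReflection {m m' v w : ℂ} (h : m ≠ m') (hm : ‖w - m‖ = ‖v - m‖)
    (hm' : ‖w - m'‖ = ‖v - m'‖) : w = v ∨ w = lineReflection m m' v := by
  have h1 : conj (m' - m) ≠ 0 := (map_ne_zero _).2 (sub_ne_zero.2 h.symm)
  have e := lineReflection_sub_mul h v
  have a := mul_conj_eq_of_norm_eq hm
  have b := mul_conj_eq_of_norm_eq hm'
  have key : (w - v) * conj (m' - m) * ((w - lineReflection m m' v) * conj (m' - m)) = 0 := by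
    simp only [map_sub] at *
    linear_combination ((w - v) * (conj m' - conj m)) * (-e)
      + ((w - m) * (conj m' - conj m) - (m' - m) * (conj m' - conj m)) * a
      - (w - m) * (conj m' - conj m) * b
  rcases mul_eq_zero.1 key with k | k
  · exact .inl (sub_eq_zero.1 ((mul_eq_zero.1 k).resolve_right h1))
  · exact .inr (sub_eq_zero.1 ((mul_eq_zero.1 k).resolve_right h1))

theorem sphere_inter_sphere {m m' v : ℂ} {r r' : ℝ} (h : m ≠ m') (hv : v ∈ Metric.sphere m r)
    (hv' : v ∈ Metric.sphere m' r') :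
    Metric.sphere m r ∩ Metric.sphere m' r' = {v, lineReflection m m' v} := by
  rw [mem_sphere_iff_norm] at hv hv'
  ext w
  simp only [Set.mem_inter_iff, mem_sphere_iff_norm, Set.mem_insert_iff, Set.mem_singleton_iff]
  constructor
  · rintro ⟨a, b⟩
    exact eq_or_eq_lineReflection h (a.trans hv.symm) (b.trans hv'.symm)
  · rintro (rfl | rfl)
    · exact ⟨hv, hv'⟩
    · exact ⟨(norm_lineReflection_sub_left h v).trans hv,
        (norm_lineReflection_sub_right h v).trans hv'⟩

/-- Successive reflections about lines through a common point `m` compose by multiplying the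
directions, so the relation only depends on the directions up to real factors. -/
theorem lineReflection_lineReflection {m a b p q v : ℂ} {κ s : ℝ} (ha : m ≠ a) (hb : m ≠ b)
    (hp : m ≠ p) (hq : m ≠ q) (hs : s ≠ 0)
    (h : (κ : ℂ) * ((m - p) * (m - q)) = s * ((m - a) * (m - b))) :
    lineReflection m b (lineReflection m p v) = lineReflection m q (lineReflection m a v) := by
  have nz : ∀ {x : ℂ}, m ≠ x →
      m - x ≠ 0 ∧ conj m - conj x ≠ 0 ∧ x - m ≠ 0 ∧ conj x - conj m ≠ 0 := by
    intro x hx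
    have h1 : m - x ≠ 0 := sub_ne_zero.2 hx
    have h2 : x - m ≠ 0 := sub_ne_zero.2 hx.symm
    refine ⟨h1, ?_, h2, ?_⟩
    · rw [← map_sub]; exact (map_ne_zero _).2 h1
    · rw [← map_sub]; exact (map_ne_zero _).2 h2
  obtain ⟨a1, a2, a3, a4⟩ := nz ha
  obtain ⟨b1, b2, b3, b4⟩ := nz hb
  obtain ⟨p1, p2, p3, p4⟩ := nz hp
  obtain ⟨q1, q2, q3, q4⟩ := nz hq
  have hs' : (s : ℂ) ≠ 0 := by exact_mod_cast hs
  have hκ : (κ : ℂ) ≠ 0 := by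
    rintro h0
    rw [h0, zero_mul] at h
    exact mul_ne_zero hs' (mul_ne_zero a1 b1) h.symm
  have hc := congrArg conj h
  simp only [map_mul, map_sub, Complex.conj_ofReal] at hc
  have key : (b - m) * (conj p - conj m) * (conj q - conj m) * (a - m)
      = (conj b - conj m) * (p - m) * (q - m) * (conj a - conj m) := by
    apply mul_left_cancel₀ (mul_ne_zero hs' hκ)
    linear_combination (-(κ : ℂ) * ((conj p - conj m) * (conj q - conj m))) * h
      + (κ : ℂ) * (m - p) * (m - q) * hc
  unfold lineReflection
  simp only [map_sub, map_mul, map_div₀, Complex.conj_conj, add_sub_cancel_left]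
  congr 1
  field_simp
  linear_combination (v - m) * key

theorem exists_real_smul {a d : ℂ} (hd : d ≠ 0) (h : (a * conj d).im = 0) : ∃ s : ℝ, a = s * d := by
  refine ⟨(a / d).re, ?_⟩
  have : (a / d).im = 0 := by
    rw [Complex.div_im]
    simp only [Complex.mul_im, Complex.conj_re, Complex.conj_im] at h
    rw [← sub_div]
    rw [show a.im * d.re - a.re * d.im = 0 by linarith, zero_div]
  have e : ((a / d).re : ℂ) = a / d := by
    apply Complex.ext <;> simp [this]
  rw [e]
  field_simp

end Reflection

/-! ### The centre of the new circle -/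

/-- The second root of the quadratic polynomial `(X - y 1) (X - y 3) + t (X - y 0) (X - y 2)`, of
which `m` is the first root. -/
noncomputable def mutatedCenter (t : ℝ) (m : ℂ) (y : Fin 4 → ℂ) : ℂ :=
  (y 1 + y 3 + t * (y 0 + y 2)) / (1 + t) - m

section Center

open ComplexConjugate

variable {t : ℝ} {m : ℂ} {y : Fin 4 → ℂ}

theorem one_add_ofReal_ne_zero (ht : 0 < t) : (1 + t : ℂ) ≠ 0 := by
  have : (1 + t : ℝ) ≠ 0 := by positivity
  exact_mod_cast this

theorem one_add_mul_mutatedCenter (ht : 0 < t) :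
    (1 + t) * (m + mutatedCenter t m y) = y 1 + y 3 + t * (y 0 + y 2) := by
  have := one_add_ofReal_ne_zero ht
  unfold mutatedCenter
  field_simp
  ring

/-- The factorisation of the quadratic polynomial evaluated at its nodes. -/
theorem mutatedCenter_factor (ht : 0 < t)
    (h : -((y 1 - m) * (y 3 - m)) = t * ((y 0 - m) * (y 2 - m))) (k : Fin 4) :
    (1 + t : ℂ) * ((y k - m) * (y k - mutatedCenter t m y)) =
      (if k = 0 ∨ k = 2 then 1 else t : ℝ) * ((y k - y (k - 1)) * (y k - y (k + 1))) := by
  have e := one_add_mul_mutatedCenter (m := m) (y := y) ht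
  have key : ∀ X : ℂ, (1 + t : ℂ) * ((X - m) * (X - mutatedCenter t m y)) =
      (X - y 1) * (X - y 3) + t * ((X - y 0) * (X - y 2)) := by
    intro X
    linear_combination (m - X) * e + h
  rw [key]
  fin_cases k
  · simp [show (0 : Fin 4) - 1 = 3 from rfl]; ring
  · simp [show (1 : Fin 4) + 1 = 2 from rfl]
  · simp [show (2 : Fin 4) - 1 = 1 from rfl, show (2 : Fin 4) + 1 = 3 from rfl]
  · simp [show (3 : Fin 4) - 1 = 2 from rfl, show (3 : Fin 4) + 1 = 0 from rfl]
    left; ring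

end Center

/-! ### The Miquel configuration in the plane -/

/-- Five circles around a quadrilateral face: one with centre `m` through the points `v k`, and four
with centres `y k`, the `k`-th passing through `v (k - 1)` and `v k`; the ratio of the products of
opposite centre differences is the negative real number `-t`. -/
structure IsMiquelConfig (t ρ : ℝ) (m : ℂ) (r : Fin 4 → ℝ) (y v : Fin 4 → ℂ) : Prop where
  pos : 0 < t
  ratio : -((y 1 - m) * (y 3 - m)) = t * ((y 0 - m) * (y 2 - m))
  radius_pos : ∀ k, 0 < r k
  ne_center : ∀ k, y k ≠ m
  ne_succ : ∀ k, y k ≠ y (k + 1)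
  point_ne_succ : ∀ k, v k ≠ v (k + 1)
  mem_center : ∀ k, v k ∈ Metric.sphere m ρ
  mem : ∀ k, v k ∈ Metric.sphere (y k) (r k)
  mem_succ : ∀ k, v k ∈ Metric.sphere (y (k + 1)) (r (k + 1))

/-- The second intersection point of the circles with centres `y k` and `y (k + 1)`. -/
noncomputable def secondPoint (y v : Fin 4 → ℂ) (k : Fin 4) : ℂ :=
  lineReflection (y k) (y (k + 1)) (v k)

namespace IsMiquelConfig

open ComplexConjugate

variable {t ρ : ℝ} {m : ℂ} {r : Fin 4 → ℝ} {y v : Fin 4 → ℂ}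

theorem factor (h : IsMiquelConfig t ρ m r y v) (k : Fin 4) :
    (1 + t : ℂ) * ((y k - m) * (y k - mutatedCenter t m y)) =
      (if k = 0 ∨ k = 2 then 1 else t : ℝ) * ((y k - y (k - 1)) * (y k - y (k + 1))) :=
  mutatedCenter_factor h.pos h.ratio k

theorem sign_pos (h : IsMiquelConfig t ρ m r y v) (k : Fin 4) :
    0 < (if k = 0 ∨ k = 2 then 1 else t : ℝ) := by
  split_ifs
  · exact one_pos
  · exact h.pos

theorem ne_pred (h : IsMiquelConfig t ρ m r y v) (k : Fin 4) : y k ≠ y (k - 1) := by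
  have := h.ne_succ (k - 1)
  rw [sub_add_cancel] at this
  exact this.symm

theorem ne_mutatedCenter (h : IsMiquelConfig t ρ m r y v) (k : Fin 4) :
    y k ≠ mutatedCenter t m y := by
  intro h0
  have e := h.factor k
  rw [sub_eq_zero.2 h0, mul_zero, mul_zero] at e
  exact mul_ne_zero (Complex.ofReal_ne_zero.2 (h.sign_pos k).ne')
    (mul_ne_zero (sub_ne_zero.2 (h.ne_pred k)) (sub_ne_zero.2 (h.ne_succ k))) e.symm

theorem secondPoint_mem_succ (h : IsMiquelConfig t ρ m r y v) (k : Fin 4) :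
    secondPoint y v k ∈ Metric.sphere (y (k + 1)) (r (k + 1)) := by
  have := h.mem_succ k
  rw [mem_sphere_iff_norm] at this ⊢
  rwa [secondPoint, norm_lineReflection_sub_right (h.ne_succ k)]

theorem inter_old (h : IsMiquelConfig t ρ m r y v) (k : Fin 4) :
    Metric.sphere (y k) (r k) ∩ Metric.sphere (y (k + 1)) (r (k + 1)) =
      {v k, secondPoint y v k} :=
  sphere_inter_sphere (h.ne_succ k) (h.mem k) (h.mem_succ k)

theorem point_succ (h : IsMiquelConfig t ρ m r y v) (k : Fin 4) :
    v (k + 1) = lineReflection (y (k + 1)) m (v k) := by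
  have h1 : v (k + 1) ∈ Metric.sphere (y (k + 1)) (r (k + 1)) ∩ Metric.sphere m ρ :=
    ⟨h.mem (k + 1), h.mem_center (k + 1)⟩
  rw [sphere_inter_sphere (h.ne_center (k + 1)) (h.mem_succ k) (h.mem_center k)] at h1
  exact h1.resolve_left (h.point_ne_succ k).symm

/-- Consecutive second intersection points are mirror images about the line through the new
centre. -/
theorem secondPoint_succ (h : IsMiquelConfig t ρ m r y v) (k : Fin 4) :
    secondPoint y v (k + 1) =
      lineReflection (y (k + 1)) (mutatedCenter t m y) (secondPoint y v k) := by
  have e := h.factor (k + 1)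
  have hp := h.ne_pred (k + 1)
  rw [add_sub_cancel_right] at e hp
  rw [secondPoint, h.point_succ k, secondPoint, lineReflection_comm (h.ne_succ k)]
  refine lineReflection_lineReflection (κ := 1 + t) hp (h.ne_succ (k + 1)) (h.ne_center (k + 1))
    (h.ne_mutatedCenter (k + 1)) (h.sign_pos (k + 1)).ne' ?_
  rw [← e]
  push_cast
  ring

/-- The second intersection points lie on a circle around the new centre. -/
theorem secondPoint_mem_new (h : IsMiquelConfig t ρ m r y v) (k : Fin 4) :
    secondPoint y v k ∈
      Metric.sphere (mutatedCenter t m y) ‖secondPoint y v 0 - mutatedCenter t m y‖ := by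
  have step : ∀ k, ‖secondPoint y v (k + 1) - mutatedCenter t m y‖ =
      ‖secondPoint y v k - mutatedCenter t m y‖ := by
    intro k
    rw [h.secondPoint_succ k, norm_lineReflection_sub_right (h.ne_mutatedCenter _)]
  rw [mem_sphere_iff_norm]
  have s0 := step 0
  have s1 := step 1
  have s2 := step 2
  rw [show (0 : Fin 4) + 1 = 1 from rfl] at s0
  rw [show (1 : Fin 4) + 1 = 2 from rfl] at s1
  rw [show (2 : Fin 4) + 1 = 3 from rfl] at s2
  fin_cases k
  · rfl
  · exact s0
  · exact s1.trans s0
  · exact s2.trans (s1.trans s0)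

theorem inter_new (h : IsMiquelConfig t ρ m r y v) (k : Fin 4) :
    Metric.sphere (mutatedCenter t m y) ‖secondPoint y v 0 - mutatedCenter t m y‖ ∩
        Metric.sphere (y (k + 1)) (r (k + 1)) = {secondPoint y v k, secondPoint y v (k + 1)} := by
  rw [h.secondPoint_succ k, lineReflection_comm (h.ne_mutatedCenter _)]
  exact sphere_inter_sphere (h.ne_mutatedCenter _).symm (h.secondPoint_mem_new k)
    (h.secondPoint_mem_succ k)

theorem norm_mutatedCenter (h : IsMiquelConfig t ρ m r y v) (k : Fin 4) :
    (1 + t) * (‖y k - m‖ * ‖y k - mutatedCenter t m y‖) =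
      (if k = 0 ∨ k = 2 then 1 else t) * (‖y k - y (k - 1)‖ * ‖y k - y (k + 1)‖) := by
  have e := congrArg norm (h.factor k)
  have h1 : ‖(1 + t : ℂ)‖ = 1 + t := by
    have : (1 + t : ℂ) = ((1 + t : ℝ) : ℂ) := by push_cast; rfl
    rw [this, Complex.norm_real, Real.norm_of_nonneg]
    linarith [h.pos]
  rw [norm_mul, norm_mul, norm_mul, norm_mul, h1, Complex.norm_real,
    Real.norm_of_nonneg (h.sign_pos k).le] at e
  exact e

theorem norm_ratio (h : IsMiquelConfig t ρ m r y v) :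
    ‖y 1 - m‖ * ‖y 3 - m‖ = t * (‖y 0 - m‖ * ‖y 2 - m‖) := by
  have e := congrArg norm h.ratio
  rwa [norm_neg, norm_mul, norm_mul, norm_mul, Complex.norm_real, Real.norm_of_nonneg h.pos.le] at e

/-- The transformation rule of the square in urban renewal. -/
theorem norm_mutatedCenter_add_two (h : IsMiquelConfig t ρ m r y v) (k : Fin 4) :
    ‖y (k + 2) - mutatedCenter t m y‖ *
        (‖y 0 - m‖ * ‖y 2 - m‖ + ‖y 1 - m‖ * ‖y 3 - m‖) =
      ‖y (k + 1) - y (k + 2)‖ * ‖y (k + 2) - y (k + 3)‖ * ‖y k - m‖ := by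
  have e := h.norm_mutatedCenter (k + 2)
  have hr := h.norm_ratio
  have hn : ∀ k, ‖y k - m‖ ≠ 0 := fun k => norm_ne_zero_iff.2 (sub_ne_zero.2 (h.ne_center k))
  rw [show k + 2 - 1 = k + 1 by fin_cases k <;> rfl, show k + 2 + 1 = k + 3 by fin_cases k <;> rfl,
    norm_sub_rev (y (k + 2)) (y (k + 1))] at e
  rw [hr]
  apply mul_left_cancel₀ (hn (k + 2))
  fin_cases k <;> simp [-mul_eq_mul_left_iff] at e ⊢
  · linear_combination (‖y 0 - m‖ * ‖y 2 - m‖) * e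
  · linear_combination (‖y 0 - m‖ * ‖y 2 - m‖) * e - (‖y 2 - y 3‖ * ‖y 3 - y 0‖) * hr
  · linear_combination (‖y 0 - m‖ * ‖y 2 - m‖) * e
  · linear_combination (‖y 0 - m‖ * ‖y 2 - m‖) * e - (‖y 0 - y 1‖ * ‖y 1 - y 2‖) * hr

/-- If the new centre and the four outer centres are on a line, then so is the old centre. -/
theorem collinear (h : IsMiquelConfig t ρ m r y v) {d : ℂ}
    (hd : ∀ k, ∃ s : ℝ, y k = mutatedCenter t m y + s * d) :
    ∃ s : ℝ, m = mutatedCenter t m y + s * d := by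
  have e := one_add_mul_mutatedCenter (m := m) (y := y) h.pos
  have h1 := one_add_ofReal_ne_zero h.pos
  choose s hs using hd
  refine ⟨(s 1 + s 3 + t * (s 0 + s 2)) / (1 + t), ?_⟩
  push_cast
  field_simp
  linear_combination e + hs 1 + hs 3 + t * (hs 0 + hs 2)

theorem secondPoint_ne (h : IsMiquelConfig t ρ m r y v) (k : Fin 4) :
    secondPoint y v k ≠ y (k + 1) := by
  intro h0
  have := h.secondPoint_mem_succ k
  rw [h0, mem_sphere_iff_norm, sub_self, norm_zero] at this
  exact (h.radius_pos (k + 1)).ne this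

/-- A circle meeting each outer circle exactly in its two new points has the new centre. -/
theorem eq_mutatedCenter_of_inter (h : IsMiquelConfig t ρ m r y v)
    (hl : ¬ ∃ p d : ℂ, d ≠ 0 ∧ (∃ s : ℝ, m = p + s * d) ∧ ∀ k, ∃ s : ℝ, y k = p + s * d)
    {n : ℂ} {R : ℝ} (hn : ∀ k, Metric.sphere n R ∩ Metric.sphere (y (k + 1)) (r (k + 1)) =
      {secondPoint y v k, secondPoint y v (k + 1)}) : n = mutatedCenter t m y := by
  by_contra hne
  have hd : n - mutatedCenter t m y ≠ 0 := sub_ne_zero.2 hne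
  have key : ∀ k, ∃ s : ℝ, y k = mutatedCenter t m y + s * (n - mutatedCenter t m y) := by
    intro k
    obtain ⟨k, rfl⟩ : ∃ j, j + 1 = k := ⟨k - 1, sub_add_cancel k 1⟩
    have hm : secondPoint y v k ∈ Metric.sphere n R ∩ Metric.sphere (y (k + 1)) (r (k + 1)) := by
      rw [hn k]; exact .inl rfl
    by_cases hy : y (k + 1) = n
    · exact ⟨1, by rw [hy]; push_cast; ring⟩
    · have h2 : ({secondPoint y v k, secondPoint y v (k + 1)} : Set ℂ) =
          {secondPoint y v k, lineReflection (y (k + 1)) n (secondPoint y v k)} := by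
        rw [← hn k, lineReflection_comm hy]
        exact sphere_inter_sphere (Ne.symm hy) hm.1 hm.2
      have h3 : secondPoint y v (k + 1) = lineReflection (y (k + 1)) n (secondPoint y v k) := by
        have := Set.pair_eq_pair_iff.1 h2
        rcases this with h | h
        · exact h.2
        · exact h.2.trans h.1
      have e1 := lineReflection_sub_mul hy (secondPoint y v k)
      have e2 := lineReflection_sub_mul (h.ne_mutatedCenter (k + 1)) (secondPoint y v k)
      rw [← h3] at e1
      rw [← h.secondPoint_succ] at e2
      have hw : conj (secondPoint y v k - y (k + 1)) ≠ 0 :=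
        (map_ne_zero _).2 (sub_ne_zero.2 (h.secondPoint_ne k))
      have e3 : (n - y (k + 1)) * conj (mutatedCenter t m y - y (k + 1)) =
          (mutatedCenter t m y - y (k + 1)) * conj (n - y (k + 1)) := by
        apply mul_right_cancel₀ hw
        linear_combination (-conj (mutatedCenter t m y - y (k + 1))) * e1
          + conj (n - y (k + 1)) * e2
      have e4 : ((y (k + 1) - mutatedCenter t m y) * conj (n - mutatedCenter t m y)).im = 0 := by
        rw [← Complex.conj_eq_iff_im]
        simp only [map_mul, map_sub, Complex.conj_conj] at e3 ⊢
        linear_combination -e3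
      obtain ⟨s, hs⟩ := exists_real_smul hd e4
      exact ⟨s, by rw [← hs]; ring⟩
  exact hl ⟨_, _, hd, h.collinear key, key⟩

/-- No line meets each outer circle exactly in its two new points. -/
theorem not_line_inter (h : IsMiquelConfig t ρ m r y v)
    (hl : ¬ ∃ p d : ℂ, d ≠ 0 ∧ (∃ s : ℝ, m = p + s * d) ∧ ∀ k, ∃ s : ℝ, y k = p + s * d)
    {p d : ℂ} (hd : d ≠ 0)
    (hn : ∀ k, Set.range (fun s : ℝ => p + s * d) ∩ Metric.sphere (y (k + 1)) (r (k + 1)) =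
      {secondPoint y v k, secondPoint y v (k + 1)}) : False := by
  have hd' : Complex.I * d ≠ 0 := mul_ne_zero Complex.I_ne_zero hd
  have key : ∀ k, ∃ s : ℝ, y k = mutatedCenter t m y + s * (Complex.I * d) := by
    intro k
    obtain ⟨k, rfl⟩ : ∃ j, j + 1 = k := ⟨k - 1, sub_add_cancel k 1⟩
    suffices hs : d * conj (mutatedCenter t m y - y (k + 1)) +
        conj d * (mutatedCenter t m y - y (k + 1)) = 0 by
      have e4 : ((y (k + 1) - mutatedCenter t m y) * conj (Complex.I * d)).im = 0 := by
        rw [← Complex.conj_eq_iff_im]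
        simp only [map_mul, map_sub, Complex.conj_conj, Complex.conj_I, map_neg] at hs ⊢
        linear_combination -Complex.I * hs
      obtain ⟨s, hs⟩ := exists_real_smul hd' e4
      exact ⟨s, by rw [← hs]; ring⟩
    have hm : secondPoint y v k ∈
        Set.range (fun s : ℝ => p + s * d) ∩ Metric.sphere (y (k + 1)) (r (k + 1)) := by
      rw [hn k]; exact .inl rfl
    have hm' : secondPoint y v (k + 1) ∈
        Set.range (fun s : ℝ => p + s * d) ∩ Metric.sphere (y (k + 1)) (r (k + 1)) := by
      rw [hn k]; exact .inr rfl
    obtain ⟨⟨s, hs⟩, hr⟩ := hm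
    obtain ⟨⟨s', hs'⟩, hr'⟩ := hm'
    simp only at hs hs'
    have hr2 := mul_conj_eq_of_norm_eq
      ((mem_sphere_iff_norm.1 hr').trans (mem_sphere_iff_norm.1 hr).symm)
    by_cases heq : secondPoint y v (k + 1) = secondPoint y v k
    · -- The line is tangent to the outer circle, since its other intersection point with the circle
      -- must agree with the point of contact.
      set w := secondPoint y v k with hw
      set n := y (k + 1) with hny
      have hdd : d * conj d ≠ 0 := mul_ne_zero hd ((map_ne_zero _).2 hd)
      have hwn : w - n ≠ 0 := sub_ne_zero.2 (h.secondPoint_ne k)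
      set a : ℝ := 2 * (d * conj (w - n)).re / Complex.normSq d with ha
      have haC : (a : ℂ) * (d * conj d) = d * conj (w - n) + conj d * (w - n) := by
        rw [ha, Complex.mul_conj, ← Complex.ofReal_mul, div_mul_cancel₀, ← Complex.add_conj]
        · simp
        · simpa using hd
      have hmem : w - a * d ∈
          Set.range (fun s : ℝ => p + s * d) ∩ Metric.sphere n (r (k + 1)) := by
        refine ⟨⟨s - a, ?_⟩, ?_⟩
        · simp only [← hs]; push_cast; ring
        · rw [mem_sphere_iff_norm] at hr ⊢
          rw [← hr]
          have : (w - a * d - n) * conj (w - a * d - n) = (w - n) * conj (w - n) := by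
            simp only [map_sub, map_mul, Complex.conj_ofReal] at haC ⊢
            linear_combination (a : ℂ) * haC
          rw [Complex.mul_conj, Complex.mul_conj] at this
          have := Complex.ofReal_injective this
          rw [Complex.normSq_eq_norm_sq, Complex.normSq_eq_norm_sq] at this
          exact (pow_left_inj₀ (norm_nonneg _) (norm_nonneg _) two_ne_zero).1 this
      rw [hn k, heq, Set.pair_eq_singleton, Set.mem_singleton_iff] at hmem
      have ha0 : (a : ℂ) = 0 := by
        have : (a : ℂ) * d = 0 := by linear_combination -hmem
        exact (mul_eq_zero.1 this).resolve_right hd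
      rw [ha0, zero_mul] at haC
      have e2 := lineReflection_sub_mul (h.ne_mutatedCenter (k + 1)) w
      rw [← h.secondPoint_succ, heq] at e2
      have e5 : ((mutatedCenter t m y - n) * conj (w - n)).im = 0 := by
        rw [← Complex.conj_eq_iff_im]
        simp only [map_mul, Complex.conj_conj]
        linear_combination e2
      obtain ⟨c, hc⟩ := exists_real_smul hwn e5
      rw [hc]
      simp only [map_mul, Complex.conj_ofReal]
      linear_combination -(c : ℂ) * haC
    · have hR := mul_conj_eq_of_norm_eq
        ((mem_sphere_iff_norm.1 (h.secondPoint_mem_new (k + 1))).trans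
          (mem_sphere_iff_norm.1 (h.secondPoint_mem_new k)).symm)
      have hne : ((s' - s : ℝ) : ℂ) ≠ 0 := by
        rw [Complex.ofReal_ne_zero]
        intro h0
        apply heq
        rw [← hs, ← hs', sub_eq_zero.1 h0]
      apply mul_left_cancel₀ hne
      rw [← hs, ← hs'] at hr2 hR
      simp only [map_sub, map_add, map_mul, Complex.conj_ofReal] at hr2 hR ⊢
      push_cast
      linear_combination hr2 - hR
  exact hl ⟨_, _, hd', h.collinear key, key⟩

end IsMiquelConfig

/-! ### The surface graph around a quadrilateral -/

namespace BipartiteMap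

variable {V E F : Type*} {G : BipartiteMap V E F} {f : F} {e : Fin 4 → E}

theorem cornerColor_add_one (k : Fin 4) : cornerColor (k + 1) = !cornerColor k := by
  revert k; decide

theorem cornerColor_sub_one (k : Fin 4) : cornerColor (k - 1) = !cornerColor k := by
  revert k; decide

namespace IsSurfaceGraph

theorem endpt_next (hG : G.IsSurfaceGraph) (c : Bool) {x : E} (hx : x ∈ G.edges) :
    G.endpt c (G.next c x) = G.endpt c x :=
  ((hG.endpt_eq_iff c x hx _ (hG.next_mem c x hx)).2 ⟨1, rfl⟩).symm

/-- As the edges at a vertex form one orbit of `next c`, this map permutes the edges. -/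
theorem exists_next_eq (hG : G.IsSurfaceGraph) (c : Bool) {x : E} (hx : x ∈ G.edges) :
    ∃ y ∈ G.edges, G.next c y = x := by
  obtain ⟨n, hn⟩ := (hG.endpt_eq_iff c _ (hG.next_mem c x hx) x hx).1 (hG.endpt_next c hx)
  refine ⟨(G.next c)^[n] x, ?_, ?_⟩
  · clear hn
    induction n with
    | zero => exact hx
    | succ n ih => rw [Function.iterate_succ_apply']; exact hG.next_mem c _ ih
  · rw [← Function.iterate_succ_apply' (G.next c), Function.iterate_succ_apply, hn]

theorem next_injOn [Finite E] (hG : G.IsSurfaceGraph) (c : Bool) :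
    Set.InjOn (G.next c) G.edges := by
  have hfin : G.edges.Finite := Set.toFinite _
  have hm : Set.MapsTo (G.next c) G.edges G.edges := fun x hx => hG.next_mem c x hx
  have hs : Set.SurjOn (G.next c) G.edges G.edges := fun x hx => by
    obtain ⟨y, hy, h⟩ := hG.exists_next_eq c hx
    exact ⟨y, hy, h⟩
  exact ((hfin.surjOn_iff_bijOn_of_mapsTo hm).1 hs).injOn

theorem left_next_true (hG : G.IsSurfaceGraph) {x : E} (hx : x ∈ G.edges) :
    G.left (G.next true x) = G.right x := by
  obtain ⟨y, hy, rfl⟩ := hG.exists_next_eq false hx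
  rw [hG.right_next y hy]
  exact ((hG.left_eq_iff y hy _ (hG.next_mem _ _ hx)).2 ⟨1, rfl⟩).symm

theorem endpt_mem_verts (hG : G.IsSurfaceGraph) (c : Bool) {x : E} (hx : x ∈ G.edges) :
    G.endpt c x ∈ G.verts :=
  (hG.mem_verts_iff _).2 ⟨c, x, hx, rfl⟩

theorem color_eq (hG : G.IsSurfaceGraph) {c c' : Bool} {x y : E} (hx : x ∈ G.edges)
    (hy : y ∈ G.edges) (h : G.endpt c x = G.endpt c' y) : c = c' := by
  cases c <;> cases c'
  · rfl
  · exact absurd h.symm (hG.bipartite y hy x hx)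
  · exact absurd h (hG.bipartite x hx y hy)
  · rfl

end IsSurfaceGraph

/-- A quadrilateral face with four different neighbours in a surface graph in which no face is
adjacent to itself. -/
structure IsGoodQuad (G : BipartiteMap V E F) (f : F) (e : Fin 4 → E) : Prop where
  surface : G.IsSurfaceGraph
  quad : G.IsQuadrilateral f e
  left_ne_right : ∀ x ∈ G.edges, G.left x ≠ G.right x
  nbr_injective : Function.Injective (G.nbr e)

namespace IsGoodQuad

theorem next_true_one (h : G.IsGoodQuad f e) : G.next true (e 1) = e 0 := h.quad.next_eq 0
theorem next_false_two (h : G.IsGoodQuad f e) : G.next false (e 2) = e 1 := h.quad.next_eq 1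
theorem next_true_three (h : G.IsGoodQuad f e) : G.next true (e 3) = e 2 := h.quad.next_eq 2
theorem next_false_zero (h : G.IsGoodQuad f e) : G.next false (e 0) = e 3 := h.quad.next_eq 3

theorem left_two (h : G.IsGoodQuad f e) : G.left (e 2) = f := by
  rw [← h.quad.left_zero]
  exact ((h.surface.left_eq_iff _ (h.quad.mem 0) _ (h.quad.mem 2)).2
    ⟨1, by simp [h.next_false_zero, h.next_true_three]⟩).symm

theorem right_three (h : G.IsGoodQuad f e) : G.right (e 3) = f := by
  rw [← h.next_false_zero, h.surface.right_next _ (h.quad.mem 0), h.quad.left_zero]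

theorem right_one (h : G.IsGoodQuad f e) : G.right (e 1) = f := by
  rw [← h.next_false_two, h.surface.right_next _ (h.quad.mem 2), h.left_two]

theorem left_edge (h : G.IsGoodQuad f e) (k : Fin 4) :
    G.left (e k) = if cornerColor k then f else G.nbr e k := by
  fin_cases k
  · exact h.quad.left_zero
  · rfl
  · exact h.left_two
  · rfl

theorem right_edge (h : G.IsGoodQuad f e) (k : Fin 4) :
    G.right (e k) = if cornerColor k then G.nbr e k else f := by
  fin_cases k
  · rfl
  · exact h.right_one
  · rfl
  · exact h.right_three

theorem nbr_ne (h : G.IsGoodQuad f e) (k : Fin 4) : G.nbr e k ≠ f := by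
  have := h.left_ne_right _ (h.quad.mem k)
  rw [h.left_edge, h.right_edge] at this
  split_ifs at this
  · exact this.symm
  · exact this

theorem edge_injective (h : G.IsGoodQuad f e) : Function.Injective e := by
  intro j k hjk
  apply h.nbr_injective
  have hl := congrArg G.left hjk
  have hr := congrArg G.right hjk
  rw [h.left_edge, h.left_edge] at hl
  rw [h.right_edge, h.right_edge] at hr
  split_ifs at hl hr
  · exact hr
  · exact absurd hl.symm (h.nbr_ne k)
  · exact absurd hl (h.nbr_ne j)
  · exact hl

theorem left_eq_iff (h : G.IsGoodQuad f e) {x : E} (hx : x ∈ G.edges) :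
    G.left x = f ↔ x = e 0 ∨ x = e 2 := by
  constructor
  · intro hl
    obtain ⟨n, rfl⟩ := (h.surface.left_eq_iff _ (h.quad.mem 0) x hx).1
      (h.quad.left_zero.trans hl.symm)
    clear hx hl
    induction n with
    | zero => exact .inl rfl
    | succ n ih =>
      rw [Function.iterate_succ_apply']
      rcases ih with ih | ih <;> rw [ih, Function.comp_apply]
      · rw [h.next_false_zero, h.next_true_three]; exact .inr rfl
      · rw [h.next_false_two, h.next_true_one]; exact .inl rfl
  · rintro (rfl | rfl)
    · exact h.quad.left_zero
    · exact h.left_two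

theorem right_eq_iff (h : G.IsGoodQuad f e) {x : E} (hx : x ∈ G.edges) :
    G.right x = f ↔ x = e 1 ∨ x = e 3 := by
  constructor
  · intro hr
    obtain ⟨y, hy, rfl⟩ := h.surface.exists_next_eq false hx
    rw [h.surface.right_next y hy, h.left_eq_iff hy] at hr
    rcases hr with rfl | rfl
    · exact .inr h.next_false_zero
    · exact .inl h.next_false_two
  · rintro (rfl | rfl)
    · exact h.right_one
    · exact h.right_three

theorem endpt_edge (h : G.IsGoodQuad f e) (c : Bool) (k : Fin 4) :
    G.endpt c (e k) = if cornerColor k = c then G.corner e k else G.corner e (k - 1) := by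
  split_ifs with hc
  · rw [← hc]; rfl
  · have hc' : cornerColor (k - 1) = c := by
      rw [cornerColor_sub_one]
      revert hc
      cases cornerColor k <;> cases c <;> simp
    have := h.surface.endpt_next c (h.quad.mem k)
    have e1 := h.quad.next_eq (k - 1)
    rw [sub_add_cancel, hc'] at e1
    rw [← this, e1, corner, hc']

theorem leg_mem (h : G.IsGoodQuad f e) (k : Fin 4) : G.leg e k ∈ G.edges :=
  h.surface.next_mem _ _ (h.quad.mem k)

theorem corner_mem (h : G.IsGoodQuad f e) (k : Fin 4) : G.corner e k ∈ G.verts :=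
  h.surface.endpt_mem_verts _ (h.quad.mem k)

theorem farEnd_mem (h : G.IsGoodQuad f e) (k : Fin 4) : G.farEnd e k ∈ G.verts :=
  h.surface.endpt_mem_verts _ (h.leg_mem k)

theorem endpt_leg (h : G.IsGoodQuad f e) (c : Bool) (k : Fin 4) :
    G.endpt c (G.leg e k) = if cornerColor k = c then G.corner e k else G.farEnd e k := by
  split_ifs with hc
  · rw [← hc]; exact h.surface.endpt_next _ (h.quad.mem k)
  · have : c = !cornerColor k := by
      revert hc
      cases cornerColor k <;> cases c <;> simp
    rw [this]; rfl

variable [Finite E]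

/-- A contracted corner has no other edges than the two boundary edges and the leg, and the rotation
around it permutes these three cyclically. -/
theorem mem_of_endpt_eq_corner (h : G.IsGoodQuad f e) {k : Fin 4} (hk : G.Contracts e k) :
    (∀ x ∈ G.edges, ∀ c, G.endpt c x = G.corner e k → x = e (k + 1) ∨ x = e k ∨ x = G.leg e k) ∧
      G.next (cornerColor k) (G.leg e k) = e (k + 1) := by
  set c := cornerColor k with hc
  set I : Set E := {x | x ∈ G.edges ∧ ∃ c, G.endpt c x = G.corner e k} with hI
  have hcard : I.ncard = 3 := hk
  have hI' : ∀ x ∈ I, ∃ n : ℕ, (G.next c)^[n] (e (k + 1)) = x := by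
    rintro x ⟨hx, c', hc'⟩
    have : c' = c := h.surface.color_eq hx (h.quad.mem k) hc'
    subst this
    refine (h.surface.endpt_eq_iff _ _ (h.quad.mem _) x hx).1 ?_
    rw [hc', h.endpt_edge, cornerColor_add_one, hc, if_neg (by simp), add_sub_cancel_right]
  have hIm : ∀ x ∈ ({e (k + 1), e k, G.leg e k} : Set E), x ∈ I := by
    rintro x (rfl | rfl | rfl)
    · refine ⟨h.quad.mem _, c, ?_⟩
      rw [h.endpt_edge, cornerColor_add_one, hc, if_neg (by simp), add_sub_cancel_right]
    · exact ⟨h.quad.mem _, c, rfl⟩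
    · refine ⟨h.leg_mem _, c, ?_⟩
      rw [h.endpt_leg, if_pos rfl]
  have n0 : G.next c (e (k + 1)) = e k := h.quad.next_eq k
  have n1 : G.next c (e k) = G.leg e k := rfl
  have d01 : e (k + 1) ≠ e k := fun h0 => by
    have := h.edge_injective h0
    revert this
    fin_cases k <;> decide
  have d02 : G.leg e k ≠ e (k + 1) := by
    intro h0
    have hsub : I ⊆ {e (k + 1), e k} := by
      intro x hx
      obtain ⟨n, rfl⟩ := hI' x hx
      clear hx
      induction n with
      | zero => exact .inl rfl
      | succ n ih =>
        rw [Function.iterate_succ_apply']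
        rcases ih with ih | ih <;> rw [ih]
        · rw [n0]; exact .inr rfl
        · rw [n1, h0]; exact .inl rfl
    have := (Set.ncard_le_ncard hsub (Set.toFinite _)).trans (Set.ncard_insert_le _ _)
    rw [Set.ncard_singleton, hcard] at this
    omega
  have d12 : G.leg e k ≠ e k := by
    intro h0
    rw [← n1] at h0
    exact d01 (h.surface.next_injOn c (h.quad.mem _) (h.quad.mem _) (n0.trans h0.symm))
  have hEq : ({e (k + 1), e k, G.leg e k} : Set E) = I := by
    apply Set.eq_of_subset_of_ncard_le hIm _ (Set.toFinite _)
    rw [hcard, Set.ncard_insert_of_notMem, Set.ncard_insert_of_notMem, Set.ncard_singleton]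
    · exact fun h => d12 (Set.mem_singleton_iff.1 h).symm
    · rintro (h | h)
      · exact d01 h
      · exact d02 h.symm
  constructor
  · intro x hx c' hc'
    have : x ∈ I := ⟨hx, c', hc'⟩
    rw [← hEq] at this
    exact this
  · have hm : G.next c (G.leg e k) ∈ I := by
      refine ⟨h.surface.next_mem _ _ (h.leg_mem k), c, ?_⟩
      rw [h.surface.endpt_next _ (h.leg_mem k), h.endpt_leg, if_pos rfl]
    rw [← hEq] at hm
    rcases hm with hm | hm | hm
    · exact hm
    · exact absurd (h.surface.next_injOn c (h.leg_mem _) (h.quad.mem _) (hm.trans n0.symm)) d02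
    · exact absurd (h.surface.next_injOn c (h.leg_mem _) (h.quad.mem _) (hm.trans n1.symm)) d12

/-- The faces on both sides of the leg of a contracted corner. -/
theorem faces_leg (h : G.IsGoodQuad f e) {k : Fin 4} (hk : G.Contracts e k) :
    G.left (G.leg e k) = (if cornerColor k then G.nbr e k else G.nbr e (k + 1)) ∧
      G.right (G.leg e k) = (if cornerColor k then G.nbr e (k + 1) else G.nbr e k) := by
  have hn := (h.mem_of_endpt_eq_corner hk).2
  have hc := cornerColor_add_one k
  by_cases hk' : cornerColor k = true
  · rw [if_pos hk', if_pos hk']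
    rw [hk'] at hn hc
    constructor
    · rw [leg, hk', h.surface.left_next_true (h.quad.mem k), h.right_edge, if_pos hk']
    · rw [← h.surface.left_next_true (h.leg_mem k), hn, h.left_edge, hc]; rfl
  · rw [if_neg hk', if_neg hk']
    rw [Bool.not_eq_true] at hk'
    rw [hk'] at hn hc
    constructor
    · rw [← h.surface.right_next _ (h.leg_mem k), hn, h.right_edge, hc]; rfl
    · rw [leg, hk', h.surface.right_next _ (h.quad.mem k), h.left_edge, hk']; rfl

theorem leg_ne_edge (h : G.IsGoodQuad f e) {k : Fin 4} (hk : G.Contracts e k) (j : Fin 4) :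
    G.leg e k ≠ e j := by
  intro h0
  obtain ⟨hl, hr⟩ := h.faces_leg hk
  rw [h0, h.left_edge] at hl
  rw [h0, h.right_edge] at hr
  have := h.nbr_ne k
  have := h.nbr_ne (k + 1)
  split_ifs at hl hr <;> simp_all

theorem leg_injOn (h : G.IsGoodQuad f e) {j k : Fin 4} (hj : G.Contracts e j)
    (hk : G.Contracts e k) (hjk : G.leg e j = G.leg e k) : j = k := by
  obtain ⟨hl, hr⟩ := h.faces_leg hk
  obtain ⟨hl', hr'⟩ := h.faces_leg hj
  rw [hjk, hl] at hl'
  rw [hjk, hr] at hr'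
  have key : ∀ j k : Fin 4, k + 1 = j → k = j + 1 → False := by decide
  split_ifs at hl' hr'
  · exact (h.nbr_injective hl').symm
  · exact (key _ _ (h.nbr_injective hr') (h.nbr_injective hl')).elim
  · exact (key _ _ (h.nbr_injective hl') (h.nbr_injective hr')).elim
  · exact (h.nbr_injective hr').symm

/-- Opposite corners may be the same vertex of the surface graph, but not if it has degree three. -/
theorem corner_eq_corner (h : G.IsGoodQuad f e) {j k : Fin 4} (hj : G.Contracts e j)
    (hjk : G.corner e k = G.corner e j) : k = j := by
  have h1 := (h.mem_of_endpt_eq_corner hj).1 (e k) (h.quad.mem k) (cornerColor k) (by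
    rw [h.endpt_edge, if_pos rfl, hjk])
  have h2 := (h.mem_of_endpt_eq_corner hj).1 (e (k + 1)) (h.quad.mem _) (cornerColor k) (by
    rw [h.endpt_edge, cornerColor_add_one, if_neg (by simp), add_sub_cancel_right, hjk])
  have key : ∀ j k : Fin 4, (k = j + 1 ∨ k = j) → (k + 1 = j + 1 ∨ k + 1 = j) → k = j := by decide
  refine key j k ?_ ?_
  · rcases h1 with h1 | h1 | h1
    · exact .inl (h.edge_injective h1)
    · exact .inr (h.edge_injective h1)
    · exact absurd h1.symm (h.leg_ne_edge hj k)
  · rcases h2 with h1 | h1 | h1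
    · exact .inl (h.edge_injective h1)
    · exact .inr (h.edge_injective h1)
    · exact absurd h1.symm (h.leg_ne_edge hj (k + 1))

theorem farEnd_ne_corner (h : G.IsGoodQuad f e) {j k : Fin 4} (hj : G.Contracts e j)
    (hk : G.Contracts e k) : G.farEnd e k ≠ G.corner e j := by
  intro h0
  have h1 := (h.mem_of_endpt_eq_corner hj).1 (G.leg e k) (h.leg_mem k) _ h0
  rcases h1 with h1 | h1 | h1
  · exact h.leg_ne_edge hk _ h1
  · exact h.leg_ne_edge hk _ h1
  · have := h.leg_injOn hk hj h1
    subst this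
    have := h.surface.color_eq (h.leg_mem k) (h.quad.mem k) h0
    revert this
    cases cornerColor k <;> simp

end IsGoodQuad

end BipartiteMap

/-! ### The local identity of urban renewal -/

/-- The number of edges of `P` at the `k`-th corner of a quadrilateral, for a set `P` of its edges,
which are labelled so that the `k`-th edge joins the corners `k - 1` and `k`. -/
def coverage (P : Finset (Fin 4)) (k : Fin 4) : ℕ :=
  (if k ∈ P then 1 else 0) + if k + 1 ∈ P then 1 else 0

theorem sum_endpoints_eq_sum_coverage (P : Finset (Fin 4)) (φ : Fin 4 → ℕ) :
    ∑ k ∈ P, (φ (k - 1) + φ k) = ∑ k, coverage P k * φ k := by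
  have h : ∑ k ∈ P, (φ (k - 1) + φ k) = ∑ k, if k ∈ P then φ (k - 1) + φ k else 0 := by
    rw [Finset.sum_ite_mem, Finset.univ_inter]
  rw [h]
  simp only [coverage, Fin.sum_univ_four, add_mul, ite_mul, one_mul, zero_mul,
    show (0 : Fin 4) - 1 = 3 from rfl, show (1 : Fin 4) - 1 = 0 from rfl,
    show (2 : Fin 4) - 1 = 1 from rfl, show (3 : Fin 4) - 1 = 2 from rfl,
    show (0 : Fin 4) + 1 = 1 from rfl, show (1 : Fin 4) + 1 = 2 from rfl,
    show (2 : Fin 4) + 1 = 3 from rfl, show (3 : Fin 4) + 1 = 0 from rfl]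
  split_ifs <;> ring

theorem filter_coverage_le_one :
    (Finset.univ.filter fun P : Finset (Fin 4) => ∀ k, coverage P k ≤ 1) =
      {∅, {0}, {1}, {2}, {3}, {0, 2}, {1, 3}} := by
  decide

theorem sum_coverage_le_one (φ : Finset (Fin 4) → ℝ) :
    (∑ P : Finset (Fin 4) with ∀ k, coverage P k ≤ 1, φ P) =
      φ ∅ + φ {0} + φ {1} + φ {2} + φ {3} + φ {0, 2} + φ {1, 3} := by
  rw [filter_coverage_le_one]
  rw [Finset.sum_insert (by decide), Finset.sum_insert (by decide), Finset.sum_insert (by decide),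
    Finset.sum_insert (by decide), Finset.sum_insert (by decide), Finset.sum_insert (by decide),
    Finset.sum_singleton]
  ring

/-- Urban renewal of a square with edge weights `d`: after the move, the square has the weights
`d'` and each of its corners sees a new leg of weight `l k`, which a matching uses exactly if it
does not cover the new corner by an edge of the square. The set of corners of the old square that
are covered from inside corresponds to the complement of the set of the new corners that are covered
by the new square. The function `g` is the weight of the outside, given the covered corners. -/
theorem local_urban_renewal {l d d' : Fin 4 → ℝ} {D : ℝ} (hD : D = d 0 * d 2 + d 1 * d 3)
    (hD0 : D ≠ 0) (h : ∀ k, d' (k + 2) * D = l (k + 1) * l (k + 2) * d k)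
    (g : (Fin 4 → ℕ) → ℝ) :
    (∏ k, l k) / D * ∑ P : Finset (Fin 4) with ∀ k, coverage P k ≤ 1,
        (∏ k ∈ P, d k) * g (coverage P) =
      ∑ P : Finset (Fin 4) with ∀ k, coverage P k ≤ 1,
        (∏ k ∈ P, d' k) * (∏ k with coverage P k = 0, l k) * g fun k => 1 - coverage P k := by
  rw [sum_coverage_le_one, sum_coverage_le_one]
  have c1 : (fun k => 1 - coverage ∅ k) = fun _ => 1 := by decide
  have c2 : (fun k => 1 - coverage {0} k) = coverage {2} := by decide
  have c3 : (fun k => 1 - coverage {1} k) = coverage {3} := by decide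
  have c4 : (fun k => 1 - coverage {2} k) = coverage {0} := by decide
  have c5 : (fun k => 1 - coverage {3} k) = coverage {1} := by decide
  have c6 : (fun k => 1 - coverage {0, 2} k) = fun _ => 0 := by decide
  have c7 : (fun k => 1 - coverage {1, 3} k) = fun _ => 0 := by decide
  have c8 : coverage {0, 2} = fun _ => 1 := by decide
  have c9 : coverage {1, 3} = fun _ => 1 := by decide
  have c10 : coverage ∅ = fun _ => 0 := by decide
  have f1 : (Finset.univ.filter fun k => coverage ∅ k = 0) = Finset.univ := by decide
  have f2 : (Finset.univ.filter fun k => coverage {0} k = 0) = {1, 2} := by decide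
  have f3 : (Finset.univ.filter fun k => coverage {1} k = 0) = {2, 3} := by decide
  have f4 : (Finset.univ.filter fun k => coverage {2} k = 0) = {3, 0} := by decide
  have f5 : (Finset.univ.filter fun k => coverage {3} k = 0) = {0, 1} := by decide
  have f6 : (Finset.univ.filter fun k => coverage {0, 2} k = 0) = ∅ := by decide
  have f7 : (Finset.univ.filter fun k => coverage {1, 3} k = 0) = ∅ := by decide
  rw [f1, f2, f3, f4, f5, f6, f7, c1, c2, c3, c4, c5, c6, c7, c8, c9, c10]
  have h0 := h 0
  have h1 := h 1
  have h2 := h 2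
  have h3 := h 3
  simp only [show (0 : Fin 4) + 1 = 1 from rfl, show (1 : Fin 4) + 1 = 2 from rfl,
    show (2 : Fin 4) + 1 = 3 from rfl, show (3 : Fin 4) + 1 = 0 from rfl,
    show (0 : Fin 4) + 2 = 2 from rfl, show (1 : Fin 4) + 2 = 3 from rfl,
    show (2 : Fin 4) + 2 = 0 from rfl, show (3 : Fin 4) + 2 = 1 from rfl] at h0 h1 h2 h3
  rw [Finset.prod_pair (by decide), Finset.prod_pair (by decide), Finset.prod_pair (by decide),
    Finset.prod_pair (by decide), Finset.prod_pair (by decide), Finset.prod_pair (by decide),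
    Finset.prod_pair (by decide), Finset.prod_pair (by decide)]
  simp only [Finset.prod_singleton, Finset.prod_empty, Fin.prod_univ_four, one_mul, mul_one]
  rw [← eq_div_iff hD0] at h0 h1 h2 h3
  rw [h0, h1, h2, h3]
  field_simp
  rw [hD]
  ring

/-! ### Splitting matchings into an outer and an inner part -/

section Splitting

variable {α β : Type*} [DecidableEq β]

/-- The set of edges with labels `i x` for `x` in the outer part `A`, `s k` for `k` in the part `P`
of the square, and `ℓ k` for `k` in the part `L` of the legs. -/
def glueEdges (i : α → β) (s ℓ : Fin 4 → β) (A : Finset α) (P L : Finset (Fin 4)) : Finset β :=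
  A.image i ∪ P.image s ∪ L.image ℓ

/-- The labels of the outer edges in `R`, of the four edges of the square and of the legs in `K` are
all distinct. -/
structure IsSplitting (R : Finset α) (K : Finset (Fin 4)) (i : α → β) (s ℓ : Fin 4 → β) : Prop where
  injective_outer : Function.Injective i
  injective_square : Function.Injective s
  injOn_leg : Set.InjOn ℓ K
  outer_ne_square : ∀ x ∈ R, ∀ k, i x ≠ s k
  outer_ne_leg : ∀ x ∈ R, ∀ k ∈ K, i x ≠ ℓ k
  square_ne_leg : ∀ j, ∀ k ∈ K, s j ≠ ℓ k

namespace IsSplitting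

variable {R A : Finset α} {K P L : Finset (Fin 4)} {i : α → β} {s ℓ : Fin 4 → β}

@[to_additive]
theorem prod_glueEdges {M : Type*} [CommMonoid M] (h : IsSplitting R K i s ℓ) (hA : A ⊆ R)
    (hL : L ⊆ K) (φ : β → M) :
    ∏ x ∈ glueEdges i s ℓ A P L, φ x =
      (∏ x ∈ A, φ (i x)) * (∏ k ∈ P, φ (s k)) * ∏ k ∈ L, φ (ℓ k) := by
  rw [glueEdges, Finset.prod_union, Finset.prod_union,
    Finset.prod_image fun x _ y _ => @h.injective_outer x y,
    Finset.prod_image fun x _ y _ => @h.injective_square x y,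
    Finset.prod_image fun x hx y hy => @h.injOn_leg x (hL hx) y (hL hy)]
  · simp only [Finset.disjoint_left, Finset.mem_image, not_exists, not_and]
    rintro _ ⟨x, hx, rfl⟩ k _
    exact (h.outer_ne_square x (hA hx) k).symm
  · simp only [Finset.disjoint_left, Finset.mem_image, Finset.mem_union, not_exists, not_and]
    rintro _ (⟨x, hx, rfl⟩ | ⟨j, hj, rfl⟩) k hk
    · exact (h.outer_ne_leg x (hA hx) k (hL hk)).symm
    · exact (h.square_ne_leg j k (hL hk)).symm

theorem outer_mem_glueEdges (h : IsSplitting R K i s ℓ) (hL : L ⊆ K) {x : α} (hx : x ∈ R) :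
    i x ∈ glueEdges i s ℓ A P L ↔ x ∈ A := by
  simp only [glueEdges, Finset.mem_union, Finset.mem_image]
  constructor
  · rintro ((⟨y, hy, hyx⟩ | ⟨k, _, hk⟩) | ⟨k, hk, hk'⟩)
    · rwa [← h.injective_outer hyx]
    · exact absurd hk.symm (h.outer_ne_square x hx k)
    · exact absurd hk'.symm (h.outer_ne_leg x hx k (hL hk))
  · exact fun hA => .inl (.inl ⟨x, hA, rfl⟩)

theorem square_mem_glueEdges (h : IsSplitting R K i s ℓ) (hA : A ⊆ R) (hL : L ⊆ K) {k : Fin 4} :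
    s k ∈ glueEdges i s ℓ A P L ↔ k ∈ P := by
  simp only [glueEdges, Finset.mem_union, Finset.mem_image]
  constructor
  · rintro ((⟨y, hy, hyx⟩ | ⟨j, hj, hk⟩) | ⟨j, hj, hk⟩)
    · exact absurd hyx (h.outer_ne_square y (hA hy) k)
    · rwa [← h.injective_square hk]
    · exact absurd hk.symm (h.square_ne_leg k j (hL hj))
  · exact fun hP => .inl (.inr ⟨k, hP, rfl⟩)

/-- If exactly the gluings with legs at the corners that are not covered by the square, and with
outer and square part satisfying `Φ`, count as matchings, then the sum over the matchings is a sum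
over the outer and square parts. -/
theorem sum_matchings [Fintype β] (h : IsSplitting R K i s ℓ) {Mat Ext : Finset β → Prop}
    {Φ : Finset α → Finset (Fin 4) → Prop} {Q : Finset α → Prop}
    [DecidablePred fun M => Mat M ∧ Ext M] [∀ A, DecidablePred (Φ A)] [DecidablePred Q]
    (hmem : ∀ M, Mat M → ∀ x ∈ M, (∃ y ∈ R, i y = x) ∨ (∃ k, s k = x) ∨ ∃ k ∈ K, ℓ k = x)
    (hMat : ∀ A P L, A ⊆ R → L ⊆ K →
      (Mat (glueEdges i s ℓ A P L) ↔ L = {k ∈ K | coverage P k = 0} ∧ Φ A P))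
    (hExt : ∀ A P L, A ⊆ R → L ⊆ K → (Ext (glueEdges i s ℓ A P L) ↔ Q A)) (w : β → ℝ) :
    ∑ M : Finset β with Mat M ∧ Ext M, ∏ x ∈ M, w x =
      ∑ A ∈ R.powerset with Q A, (∏ x ∈ A, w (i x)) *
        ∑ P : Finset (Fin 4) with Φ A P,
          (∏ k ∈ P, w (s k)) * ∏ k ∈ K with coverage P k = 0, w (ℓ k) := by
  have hKf : ∀ P, (K.filter fun k => coverage P k = 0) ⊆ K := fun P => Finset.filter_subset _ _
  have hsplit : ∀ M, Mat M → glueEdges i s ℓ (R.filter fun x => i x ∈ M)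
      (Finset.univ.filter fun k => s k ∈ M) (K.filter fun k => ℓ k ∈ M) = M := by
    intro M hM
    ext x
    simp only [glueEdges, Finset.mem_union, Finset.mem_image, Finset.mem_filter, Finset.mem_univ,
      true_and]
    constructor
    · rintro ((⟨y, hy, rfl⟩ | ⟨j, hj, rfl⟩) | ⟨j, hj, rfl⟩)
      exacts [hy.2, hj, hj.2]
    · intro hx
      rcases hmem M hM x hx with ⟨y, hy, rfl⟩ | ⟨k, rfl⟩ | ⟨k, hk, rfl⟩
      exacts [.inl (.inl ⟨y, ⟨hy, hx⟩, rfl⟩), .inl (.inr ⟨k, hx, rfl⟩), .inr ⟨k, ⟨hk, hx⟩, rfl⟩]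
  have hchar : ∀ M, Mat M → (K.filter fun k => ℓ k ∈ M) =
        {k ∈ K | coverage (Finset.univ.filter fun k => s k ∈ M) k = 0} ∧
      Φ (R.filter fun x => i x ∈ M) (Finset.univ.filter fun k => s k ∈ M) := by
    intro M hM
    rw [← hMat _ _ _ (Finset.filter_subset _ _) (Finset.filter_subset _ _), hsplit M hM]
    exact hM
  simp_rw [Finset.mul_sum]
  rw [Finset.sum_sigma']
  refine Finset.sum_bij' (fun M _ => ⟨R.filter fun x => i x ∈ M,
      Finset.univ.filter fun k => s k ∈ M⟩)
    (fun AP _ => glueEdges i s ℓ AP.1 AP.2 (K.filter fun k => coverage AP.2 k = 0)) ?_ ?_ ?_ ?_ ?_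
  · intro M hM
    obtain ⟨hM, hE⟩ := (Finset.mem_filter.1 hM).2
    rw [← hsplit M hM, hExt _ _ _ (Finset.filter_subset _ _) (Finset.filter_subset _ _)] at hE
    simp only [Finset.mem_sigma, Finset.mem_filter, Finset.mem_powerset, Finset.mem_univ, true_and]
    exact ⟨⟨Finset.filter_subset _ _, hE⟩, (hchar M hM).2⟩
  · rintro ⟨A, P⟩ hAP
    simp only [Finset.mem_sigma, Finset.mem_filter, Finset.mem_powerset, Finset.mem_univ,
      true_and] at hAP ⊢
    exact ⟨(hMat _ _ _ hAP.1.1 (hKf P)).2 ⟨rfl, hAP.2⟩, (hExt _ _ _ hAP.1.1 (hKf P)).2 hAP.1.2⟩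
  · intro M hM
    have hM := (Finset.mem_filter.1 hM).2.1
    conv_rhs => rw [← hsplit M hM]
    rw [← (hchar M hM).1]
  · rintro ⟨A, P⟩ hAP
    simp only [Finset.mem_sigma, Finset.mem_filter, Finset.mem_powerset, Finset.mem_univ,
      true_and] at hAP
    have hA := hAP.1.1
    have e1 : (R.filter fun x => i x ∈ glueEdges i s ℓ A P (K.filter fun k => coverage P k = 0))
        = A := by
      ext x
      rw [Finset.mem_filter]
      exact ⟨fun hx => (h.outer_mem_glueEdges (hKf P) hx.1).1 hx.2,
        fun hx => ⟨hA hx, (h.outer_mem_glueEdges (hKf P) (hA hx)).2 hx⟩⟩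
    have e2 : (Finset.univ.filter fun k =>
        s k ∈ glueEdges i s ℓ A P (K.filter fun k => coverage P k = 0)) = P := by
      ext k
      rw [Finset.mem_filter, h.square_mem_glueEdges hA (hKf P)]
      simp
    simp only [e1, e2]
  · intro M hM
    have hM := (Finset.mem_filter.1 hM).2.1
    conv_lhs => rw [← hsplit M hM]
    rw [h.prod_glueEdges (Finset.filter_subset _ _) (Finset.filter_subset _ _), mul_assoc,
      ← (hchar M hM).1]

end IsSplitting

end Splitting

/-! ### Perfect matchings before and after mutation -/

namespace BipartiteMap

variable {V E F : Type*} {G : BipartiteMap V E F} {f : F} {e : Fin 4 → E}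

open Classical in
/-- The number of ends of the edge `x` at the vertex `v`. -/
noncomputable def incidence (G : BipartiteMap V E F) (v : V) (x : E) : ℕ :=
  (if G.endpt true x = v then 1 else 0) + if G.endpt false x = v then 1 else 0

theorem isPerfectMatching_iff (h : ∀ x ∈ G.edges, G.endpt true x ≠ G.endpt false x)
    (M : Finset E) : G.IsPerfectMatching M ↔
      (∀ x ∈ M, x ∈ G.edges) ∧ ∀ v ∈ G.verts, ∑ x ∈ M, G.incidence v x = 1 := by
  classical
  refine and_congr_right fun hM => forall₂_congr fun v _ => ?_
  have h1 : ∑ x ∈ M, G.incidence v x = (M.filter fun x => ∃ c, G.endpt c x = v).card := by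
    rw [Finset.card_filter]
    refine Finset.sum_congr rfl fun x hx => ?_
    have := h x (hM x hx)
    simp only [incidence, Bool.exists_bool]
    by_cases h1 : G.endpt true x = v <;> by_cases h2 : G.endpt false x = v <;> simp [h1, h2]
    exact this (h1.trans h2.symm)
  rw [h1, Finset.card_eq_one]
  constructor
  · rintro ⟨x, hx, hu⟩
    refine ⟨x, ?_⟩
    ext y
    simp only [Finset.mem_filter, Finset.mem_singleton]
    exact ⟨fun hy => hu y hy, fun hy => hy ▸ hx⟩
  · rintro ⟨x, hx⟩
    refine ⟨x, ?_, fun y hy => ?_⟩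
    · have : x ∈ ({x} : Finset E) := Finset.mem_singleton_self x
      rw [← hx, Finset.mem_filter] at this
      exact this
    · have : y ∈ M.filter fun x => ∃ c, G.endpt c x = v := Finset.mem_filter.2 hy
      rwa [hx, Finset.mem_singleton] at this

open Classical in
/-- The corners of the quadrilateral that disappear in the mutation. -/
noncomputable def contracted (G : BipartiteMap V E F) (e : Fin 4 → E) : Finset (Fin 4) :=
  {k | G.Contracts e k}

theorem mem_contracted {k : Fin 4} : k ∈ G.contracted e ↔ G.Contracts e k := by
  simp [contracted]

open Classical in
/-- The edges that are not affected by the mutation: neither boundary edges of the quadrilateral nor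
legs of contracted corners. -/
noncomputable def outerEdges [Fintype E] (G : BipartiteMap V E F) (e : Fin 4 → E) : Finset E :=
  {x | x ∈ G.edges ∧ (∀ k, x ≠ e k) ∧ ∀ k ∈ G.contracted e, x ≠ G.leg e k}

theorem mem_outerEdges [Fintype E] {x : E} : x ∈ G.outerEdges e ↔
    x ∈ G.edges ∧ (∀ k, x ≠ e k) ∧ ∀ k ∈ G.contracted e, x ≠ G.leg e k := by
  simp [outerEdges]

open Classical in
/-- The outer edges in `A` cover every remaining vertex exactly once, together with the edges inside
that are prescribed by `u`: these cover the `k`-th corner `u k` times if it is not contracted, and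
otherwise they cover the far end of its leg `1 - u k` times (which is only used for `u k ≤ 1`).
Counting per corner label makes coincidences between corners and far ends harmless. -/
def IsCompatible (G : BipartiteMap V E F) (e : Fin 4 → E) (A : Finset E) (u : Fin 4 → ℕ) : Prop :=
  ∀ v ∈ G.verts, (∀ k ∈ G.contracted e, v ≠ G.corner e k) →
    ∑ x ∈ A, G.incidence v x + ∑ k, (if k ∈ G.contracted e then
      (if G.farEnd e k = v then 1 - u k else 0) else if G.corner e k = v then u k else 0) = 1

theorem onBoundary_edge {α : Type*} (he : Function.Injective e) (g : Fin 4 → α) (d : α)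
    (k : Fin 4) : onBoundary e g d (e k) = g k := by
  fin_cases k <;> simp [onBoundary, he.eq_iff]

theorem onBoundary_of_ne {α : Type*} {x : E} (hx : ∀ k, x ≠ e k) (g : Fin 4 → α) (d : α) :
    onBoundary e g d x = d := by
  simp [onBoundary, hx]

namespace IsGoodQuad

theorem endpt_true_ne_false (h : G.IsGoodQuad f e) :
    ∀ x ∈ G.edges, G.endpt true x ≠ G.endpt false x :=
  fun x hx => h.surface.bipartite x hx x hx

open Classical in
theorem incidence_edge (h : G.IsGoodQuad f e) (v : V) (k : Fin 4) :
    G.incidence v (e k) =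
      (if G.corner e (k - 1) = v then 1 else 0) + if G.corner e k = v then 1 else 0 := by
  rw [incidence, h.endpt_edge, h.endpt_edge]
  cases cornerColor k
  · simp
  · simp [add_comm]

open Classical in
theorem incidence_leg (h : G.IsGoodQuad f e) (v : V) (k : Fin 4) :
    G.incidence v (G.leg e k) =
      (if G.corner e k = v then 1 else 0) + if G.farEnd e k = v then 1 else 0 := by
  rw [incidence, h.endpt_leg, h.endpt_leg]
  cases cornerColor k
  · simp [add_comm]
  · simp

theorem mutation_endpt_outer (c : Bool) {x : E} (hx : ∀ k, x ≠ e k) :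
    (G.mutation e).endpt c (Sum.inl x) = Sum.inl (G.endpt c x) := by
  simp only [mutation, Sum.elim_inl]
  exact onBoundary_of_ne hx _ _

theorem mutation_endpt_edge (h : G.IsGoodQuad f e) (c : Bool) (k : Fin 4) :
    (G.mutation e).endpt c (Sum.inl (e k)) =
      if cornerColor k = c then G.newCorner e (k - 1) else G.newCorner e k := by
  simp only [mutation, Sum.elim_inl]
  exact onBoundary_edge h.edge_injective _ _ k

theorem mutation_endpt_leg (c : Bool) (k : Fin 4) :
    (G.mutation e).endpt c (Sum.inr k) =
      if cornerColor k = c then Sum.inl (G.corner e k) else Sum.inr k := rfl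

open Classical in
theorem mutation_incidence_edge (h : G.IsGoodQuad f e) (w : V ⊕ Fin 4) (k : Fin 4) :
    (G.mutation e).incidence w (Sum.inl (e k)) =
      (if G.newCorner e (k - 1) = w then 1 else 0) + if G.newCorner e k = w then 1 else 0 := by
  rw [incidence, h.mutation_endpt_edge, h.mutation_endpt_edge]
  cases cornerColor k
  · simp [add_comm]
  · simp

open Classical in
theorem mutation_incidence_leg (w : V ⊕ Fin 4) (k : Fin 4) :
    (G.mutation e).incidence w (Sum.inr k) =
      (if Sum.inl (G.corner e k) = w then 1 else 0) + if Sum.inr k = w then 1 else 0 := by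
  rw [incidence, mutation_endpt_leg, mutation_endpt_leg]
  cases cornerColor k
  · simp [add_comm]
  · simp

theorem newCorner_ne (h : G.IsGoodQuad f e) (k : Fin 4) :
    G.newCorner e (k - 1) ≠ G.newCorner e k := by
  unfold newCorner
  split_ifs
  · intro h0
    have := h.surface.color_eq (h.leg_mem _) (h.leg_mem _) (Sum.inl_injective h0)
    rw [cornerColor_sub_one] at this
    revert this
    cases cornerColor k <;> simp
  · exact Sum.inl_ne_inr
  · exact Sum.inr_ne_inl
  · intro h0
    have := Sum.inr_injective h0
    revert this
    fin_cases k <;> decide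

open Classical in
theorem newCorner_eq_inr_iff (j k : Fin 4) (hj : j ∉ G.contracted e) :
    G.newCorner e k = Sum.inr j ↔ k = j := by
  rw [mem_contracted] at hj
  unfold newCorner
  split_ifs with hk
  · simp only [false_iff]
    rintro rfl
    exact hj hk
  · exact Sum.inr_injective.eq_iff

open Classical in
theorem newCorner_eq_inl_iff (v : V) (k : Fin 4) :
    G.newCorner e k = Sum.inl v ↔ k ∈ G.contracted e ∧ G.farEnd e k = v := by
  rw [mem_contracted]
  unfold newCorner
  split_ifs with hk <;> simp [hk]

variable [Fintype E]

theorem incidence_corner_of_outer (h : G.IsGoodQuad f e) {k : Fin 4} (hk : k ∈ G.contracted e)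
    {x : E} (hx : x ∈ G.outerEdges e) : G.incidence (G.corner e k) x = 0 := by
  obtain ⟨hx1, hx2, hx3⟩ := mem_outerEdges.1 hx
  have : ∀ c, G.endpt c x ≠ G.corner e k := fun c hc => by
    rcases (h.mem_of_endpt_eq_corner (mem_contracted.1 hk)).1 x hx1 c hc with h1 | h1 | h1
    · exact hx2 _ h1
    · exact hx2 _ h1
    · exact hx3 _ hk h1
  simp [incidence, this]

open Classical in
theorem isSplitting (h : G.IsGoodQuad f e) :
    IsSplitting (G.outerEdges e) (G.contracted e) id e (G.leg e) where
  injective_outer := Function.injective_id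
  injective_square := h.edge_injective
  injOn_leg := fun _ hj _ hk hjk => h.leg_injOn (mem_contracted.1 hj) (mem_contracted.1 hk) hjk
  outer_ne_square _ hx := (mem_outerEdges.1 hx).2.1
  outer_ne_leg _ hx := (mem_outerEdges.1 hx).2.2
  square_ne_leg j _ hk := (h.leg_ne_edge (mem_contracted.1 hk) j).symm

open Classical in
theorem isSplitting_mutation (h : G.IsGoodQuad f e) :
    IsSplitting (G.outerEdges e) (G.contracted e)ᶜ (Sum.inl : E → E ⊕ Fin 4)
      (fun k => Sum.inl (e k)) Sum.inr where
  injective_outer := Sum.inl_injective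
  injective_square _ _ hjk := h.edge_injective (Sum.inl_injective hjk)
  injOn_leg _ _ _ _ hjk := Sum.inr_injective hjk
  outer_ne_square _ hx k hk := (mem_outerEdges.1 hx).2.1 k (Sum.inl_injective hk)
  outer_ne_leg _ _ _ _ := Sum.inl_ne_inr
  square_ne_leg _ _ _ := Sum.inl_ne_inr

theorem mem_edges_iff (h : G.IsGoodQuad f e) (x : E) : x ∈ G.edges ↔
    (∃ y ∈ G.outerEdges e, id y = x) ∨ (∃ k, e k = x) ∨ ∃ k ∈ G.contracted e, G.leg e k = x := by
  constructor
  · intro hx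
    by_contra! h0
    exact h0.1 x (mem_outerEdges.2 ⟨hx, fun k hk => h0.2.1 k hk.symm,
      fun k hk hk' => h0.2.2 k hk hk'.symm⟩) rfl
  · rintro (⟨x, hx, rfl⟩ | ⟨k, rfl⟩ | ⟨k, _, rfl⟩)
    exacts [(mem_outerEdges.1 hx).1, h.quad.mem k, h.leg_mem k]

theorem mem_mutation_edges_iff (h : G.IsGoodQuad f e) (x : E ⊕ Fin 4) :
    x ∈ (G.mutation e).edges ↔ (∃ y ∈ G.outerEdges e, Sum.inl y = x) ∨
      (∃ k, Sum.inl (e k) = x) ∨ ∃ k ∈ (G.contracted e)ᶜ, Sum.inr k = x := by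
  constructor
  · rintro (⟨x, hx, hx', rfl⟩ | ⟨k, hk, rfl⟩)
    · by_cases h0 : ∃ k, e k = x
      · obtain ⟨k, rfl⟩ := h0
        exact .inr (.inl ⟨k, rfl⟩)
      · push Not at h0
        exact .inl ⟨x, mem_outerEdges.2 ⟨hx, fun k hk => h0 k hk.symm,
          fun k hk => hx' k (mem_contracted.1 hk)⟩, rfl⟩
    · exact .inr (.inr ⟨k, by rwa [Finset.mem_compl, mem_contracted], rfl⟩)
  · rintro (⟨x, hx, rfl⟩ | ⟨k, rfl⟩ | ⟨k, hk, rfl⟩)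
    · obtain ⟨h1, _, h2⟩ := mem_outerEdges.1 hx
      exact .inl ⟨x, h1, fun k hk => h2 k (mem_contracted.2 hk), rfl⟩
    · exact .inl ⟨e k, h.quad.mem k, fun j hj => (h.leg_ne_edge hj k).symm, rfl⟩
    · rw [Finset.mem_compl, mem_contracted] at hk
      exact .inr ⟨k, hk, rfl⟩

open Classical in
theorem sum_incidence_glueEdges (h : G.IsGoodQuad f e) {A : Finset E} {P L : Finset (Fin 4)}
    (hA : A ⊆ G.outerEdges e) (hL : L ⊆ G.contracted e) (v : V) :
    ∑ x ∈ glueEdges id e (G.leg e) A P L, G.incidence v x =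
      ∑ x ∈ A, G.incidence v x + ∑ k, coverage P k * (if G.corner e k = v then 1 else 0) +
        ∑ k ∈ L, ((if G.corner e k = v then 1 else 0) + if G.farEnd e k = v then 1 else 0) := by
  rw [h.isSplitting.sum_glueEdges hA hL]
  simp only [h.incidence_edge, h.incidence_leg, id]
  rw [sum_endpoints_eq_sum_coverage P fun k => if G.corner e k = v then 1 else 0]

open Classical in
/-- A contracted corner is covered by the square or by its leg. -/
theorem sum_incidence_contracted_corner (h : G.IsGoodQuad f e) {A : Finset E}
    {P L : Finset (Fin 4)} (hA : A ⊆ G.outerEdges e) (hL : L ⊆ G.contracted e) {j : Fin 4}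
    (hj : j ∈ G.contracted e) :
    ∑ x ∈ glueEdges id e (G.leg e) A P L, G.incidence (G.corner e j) x =
      coverage P j + if j ∈ L then 1 else 0 := by
  have hj' := mem_contracted.1 hj
  have hc : ∀ k, (G.corner e k = G.corner e j) ↔ k = j :=
    fun k => ⟨h.corner_eq_corner hj', fun hk => hk ▸ rfl⟩
  rw [h.sum_incidence_glueEdges hA hL,
    Finset.sum_eq_zero fun x hx => h.incidence_corner_of_outer hj (hA hx), zero_add]
  congr 1
  · simp [hc]
  · rw [← Finset.sum_ite_eq' L j fun _ => 1]
    refine Finset.sum_congr rfl fun k hk => ?_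
    rw [if_neg (h.farEnd_ne_corner hj' (mem_contracted.1 (hL hk))), add_zero]
    simp [hc]

open Classical in
theorem isPerfectMatching_glueEdges (h : G.IsGoodQuad f e) (A : Finset E) (P L : Finset (Fin 4))
    (hA : A ⊆ G.outerEdges e) (hL : L ⊆ G.contracted e) :
    G.IsPerfectMatching (glueEdges id e (G.leg e) A P L) ↔
      L = {k ∈ G.contracted e | coverage P k = 0} ∧
        (∀ k, coverage P k ≤ 1) ∧ G.IsCompatible e A (coverage P) := by
  have hmem : ∀ x ∈ glueEdges id e (G.leg e) A P L, x ∈ G.edges := by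
    intro x hx
    rw [h.mem_edges_iff]
    simp only [glueEdges, Finset.mem_union, Finset.mem_image] at hx
    rcases hx with (⟨y, hy, rfl⟩ | ⟨k, _, rfl⟩) | ⟨k, hk, rfl⟩
    exacts [.inl ⟨_, hA hy, rfl⟩, .inr (.inl ⟨k, rfl⟩), .inr (.inr ⟨k, hL hk, rfl⟩)]
  -- Away from the contracted corners, the ends inside the quadrilateral are counted by the
  -- compatibility condition.
  have key : L = {k ∈ G.contracted e | coverage P k = 0} → (∀ k, coverage P k ≤ 1) →
      ∀ v, (∀ k ∈ G.contracted e, v ≠ G.corner e k) →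
      ∑ x ∈ glueEdges id e (G.leg e) A P L, G.incidence v x = ∑ x ∈ A, G.incidence v x +
        ∑ k, (if k ∈ G.contracted e then (if G.farEnd e k = v then 1 - coverage P k else 0)
          else if G.corner e k = v then coverage P k else 0) := by
    intro hL' hP v hv
    rw [h.sum_incidence_glueEdges hA hL, add_assoc]
    congr 1
    rw [hL', Finset.sum_filter, ← Finset.univ_inter (G.contracted e), ← Finset.sum_ite_mem,
      ← Finset.sum_add_distrib]
    refine Finset.sum_congr rfl fun k _ => ?_
    rw [Finset.univ_inter]
    by_cases hk : k ∈ G.contracted e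
    · have := hP k
      rw [if_pos hk, if_pos hk, if_neg (hv k hk).symm]
      split_ifs <;> omega
    · rw [if_neg hk, if_neg hk]
      split_ifs <;> omega
  rw [isPerfectMatching_iff h.endpt_true_ne_false]
  constructor
  · rintro ⟨-, hM⟩
    have h1 : ∀ j ∈ G.contracted e, coverage P j + (if j ∈ L then 1 else 0) = 1 := fun j hj => by
      rw [← h.sum_incidence_contracted_corner hA hL hj]
      exact hM _ (h.corner_mem j)
    have hL' : L = {k ∈ G.contracted e | coverage P k = 0} := by
      ext k
      rw [Finset.mem_filter]
      constructor
      · intro hk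
        have := h1 k (hL hk)
        rw [if_pos hk] at this
        exact ⟨hL hk, by omega⟩
      · rintro ⟨hk, hk0⟩
        have := h1 k hk
        rw [hk0, zero_add] at this
        by_contra hkL
        rw [if_neg hkL] at this
        exact zero_ne_one this
    have hP : ∀ k, coverage P k ≤ 1 := by
      intro k
      have h2 := hM _ (h.corner_mem k)
      rw [h.sum_incidence_glueEdges hA hL] at h2
      have h3 := Finset.single_le_sum
        (f := fun j => coverage P j * (if G.corner e j = G.corner e k then 1 else 0))
        (fun j _ => Nat.zero_le _) (Finset.mem_univ k)
      simp only [if_pos, mul_one] at h3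
      omega
    exact ⟨hL', hP, fun v hv hv' => by rw [← key hL' hP v hv']; exact hM v hv⟩
  · rintro ⟨hL', hP, hc⟩
    refine ⟨hmem, fun v hv => ?_⟩
    by_cases hv' : ∀ k ∈ G.contracted e, v ≠ G.corner e k
    · rw [key hL' hP v hv']
      exact hc v hv hv'
    · push Not at hv'
      obtain ⟨j, hj, rfl⟩ := hv'
      rw [h.sum_incidence_contracted_corner hA hL hj, hL']
      have := hP j
      simp only [Finset.mem_filter, hj, true_and]
      split_ifs <;> omega

open Classical in
theorem mutation_incidence_outer {x : E} (hx : x ∈ G.outerEdges e)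
    (w : V ⊕ Fin 4) : (G.mutation e).incidence w (Sum.inl x) =
      Sum.elim (fun v => G.incidence v x) 0 w := by
  have hx' := (mem_outerEdges.1 hx).2.1
  rw [incidence, mutation_endpt_outer _ hx', mutation_endpt_outer _ hx']
  cases w <;> simp [incidence]

theorem mutation_endpt_true_ne_false (h : G.IsGoodQuad f e) :
    ∀ x ∈ (G.mutation e).edges,
      (G.mutation e).endpt true x ≠ (G.mutation e).endpt false x := by
  intro x hx
  rw [h.mem_mutation_edges_iff] at hx
  rcases hx with ⟨x, hx, rfl⟩ | ⟨k, rfl⟩ | ⟨k, _, rfl⟩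
  · obtain ⟨hx1, hx2, -⟩ := mem_outerEdges.1 hx
    rw [mutation_endpt_outer _ hx2, mutation_endpt_outer _ hx2]
    exact fun h0 => h.endpt_true_ne_false x hx1 (Sum.inl_injective h0)
  · rw [h.mutation_endpt_edge, h.mutation_endpt_edge]
    have := h.newCorner_ne k
    cases cornerColor k
    · simpa using this.symm
    · simpa using this
  · rw [mutation_endpt_leg, mutation_endpt_leg]
    cases cornerColor k <;> simp

open Classical in
theorem mutation_sum_incidence_glueEdges (h : G.IsGoodQuad f e) {A : Finset E}
    {P L : Finset (Fin 4)} (hA : A ⊆ G.outerEdges e) (hL : L ⊆ (G.contracted e)ᶜ)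
    (w : V ⊕ Fin 4) :
    ∑ x ∈ glueEdges Sum.inl (fun k => Sum.inl (e k)) Sum.inr A P L, (G.mutation e).incidence w x =
      ∑ x ∈ A, Sum.elim (fun v => G.incidence v x) 0 w +
        ∑ k, coverage P k * (if G.newCorner e k = w then 1 else 0) +
        ∑ k ∈ L,
          ((if Sum.inl (G.corner e k) = w then 1 else 0) + if Sum.inr k = w then 1 else 0) := by
  rw [h.isSplitting_mutation.sum_glueEdges hA hL]
  simp only [h.mutation_incidence_edge, mutation_incidence_leg]
  rw [sum_endpoints_eq_sum_coverage P fun k => if G.newCorner e k = w then 1 else 0,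
    Finset.sum_congr rfl fun x hx => mutation_incidence_outer (hA hx) w]

open Classical in
/-- A new corner that is not the end of an old leg is covered by the square or by its new leg. -/
theorem mutation_sum_incidence_inr (h : G.IsGoodQuad f e) {A : Finset E}
    {P L : Finset (Fin 4)} (hA : A ⊆ G.outerEdges e) (hL : L ⊆ (G.contracted e)ᶜ) {j : Fin 4}
    (hj : j ∉ G.contracted e) :
    ∑ x ∈ glueEdges Sum.inl (fun k => Sum.inl (e k)) Sum.inr A P L,
      (G.mutation e).incidence (Sum.inr j) x = coverage P j + if j ∈ L then 1 else 0 := by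
  rw [h.mutation_sum_incidence_glueEdges hA hL]
  simp [newCorner_eq_inr_iff _ _ hj]

open Classical in
theorem mutation_isPerfectMatching_glueEdges (h : G.IsGoodQuad f e) (A : Finset E)
    (P L : Finset (Fin 4)) (hA : A ⊆ G.outerEdges e) (hL : L ⊆ (G.contracted e)ᶜ) :
    (G.mutation e).IsPerfectMatching (glueEdges Sum.inl (fun k => Sum.inl (e k)) Sum.inr A P L) ↔
      L = {k ∈ (G.contracted e)ᶜ | coverage P k = 0} ∧
        (∀ k, coverage P k ≤ 1) ∧ G.IsCompatible e A (fun k => 1 - coverage P k) := by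
  have hmem : ∀ x ∈ glueEdges Sum.inl (fun k => Sum.inl (e k)) Sum.inr A P L,
      x ∈ (G.mutation e).edges := by
    intro x hx
    rw [h.mem_mutation_edges_iff]
    simp only [glueEdges, Finset.mem_union, Finset.mem_image] at hx
    rcases hx with (⟨y, hy, rfl⟩ | ⟨k, _, rfl⟩) | ⟨k, hk, rfl⟩
    exacts [.inl ⟨_, hA hy, rfl⟩, .inr (.inl ⟨k, rfl⟩), .inr (.inr ⟨k, hL hk, rfl⟩)]
  have key : L = {k ∈ (G.contracted e)ᶜ | coverage P k = 0} → (∀ k, coverage P k ≤ 1) → ∀ v,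
      ∑ x ∈ glueEdges Sum.inl (fun k => Sum.inl (e k)) Sum.inr A P L,
        (G.mutation e).incidence (Sum.inl v) x = ∑ x ∈ A, G.incidence v x +
        ∑ k, (if k ∈ G.contracted e then (if G.farEnd e k = v then 1 - (1 - coverage P k) else 0)
          else if G.corner e k = v then 1 - coverage P k else 0) := by
    intro hL' hP v
    rw [h.mutation_sum_incidence_glueEdges hA hL, add_assoc]
    congr 1
    rw [hL', Finset.sum_filter, ← Finset.univ_inter (G.contracted e)ᶜ, ← Finset.sum_ite_mem,
      ← Finset.sum_add_distrib]
    refine Finset.sum_congr rfl fun k _ => ?_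
    have := hP k
    simp only [Finset.mem_compl, newCorner_eq_inl_iff, Sum.inl.injEq,
      reduceCtorEq, if_false, add_zero]
    by_cases hk : k ∈ G.contracted e
    · simp only [hk, true_and, not_true, if_true, if_false]
      split_ifs <;> omega
    · simp only [hk, false_and, not_false_iff, if_true, if_false]
      split_ifs <;> omega
  rw [isPerfectMatching_iff h.mutation_endpt_true_ne_false]
  constructor
  · rintro ⟨-, hM⟩
    have h1 : ∀ j ∉ G.contracted e, coverage P j + (if j ∈ L then 1 else 0) = 1 := fun j hj => by
      rw [← h.mutation_sum_incidence_inr hA hL hj]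
      exact hM _ (.inr ⟨j, by rwa [← mem_contracted], rfl⟩)
    have hL' : L = {k ∈ (G.contracted e)ᶜ | coverage P k = 0} := by
      ext k
      rw [Finset.mem_filter]
      constructor
      · intro hk
        have := h1 k (Finset.mem_compl.1 (hL hk))
        rw [if_pos hk] at this
        exact ⟨hL hk, by omega⟩
      · rintro ⟨hk, hk0⟩
        have := h1 k (Finset.mem_compl.1 hk)
        rw [hk0, zero_add] at this
        by_contra hkL
        rw [if_neg hkL] at this
        exact zero_ne_one this
    have hfar : ∀ v ∈ G.verts, (∀ k ∈ G.contracted e, v ≠ G.corner e k) →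
        (Sum.inl v : V ⊕ Fin 4) ∈ (G.mutation e).verts := fun v hv hv' =>
      .inl ⟨v, hv, fun k hk => hv' k (mem_contracted.2 hk), rfl⟩
    have hP : ∀ k, coverage P k ≤ 1 := by
      intro k
      by_cases hk : k ∈ G.contracted e
      · have h2 := hM _ (hfar _ (h.farEnd_mem k) fun j hj =>
          h.farEnd_ne_corner (mem_contracted.1 hj) (mem_contracted.1 hk))
        rw [h.mutation_sum_incidence_glueEdges hA hL] at h2
        have h3 := Finset.single_le_sum
          (f := fun j => coverage P j *
            (if G.newCorner e j = Sum.inl (G.farEnd e k) then 1 else 0))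
          (fun j _ => Nat.zero_le _) (Finset.mem_univ k)
        simp only [newCorner_eq_inl_iff, hk, true_and, if_true, mul_one] at h2 h3
        omega
      · have := h1 k hk
        omega
    exact ⟨hL', hP, fun v hv hv' => by rw [← key hL' hP v]; exact hM _ (hfar v hv hv')⟩
  · rintro ⟨hL', hP, hc⟩
    refine ⟨hmem, ?_⟩
    rintro w (⟨v, hv, hv', rfl⟩ | ⟨j, hj, rfl⟩)
    · rw [key hL' hP v]
      exact hc v hv fun k hk => hv' k (mem_contracted.1 hk)
    · rw [← mem_contracted] at hj
      rw [h.mutation_sum_incidence_inr hA hL hj, hL']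
      have := hP j
      simp only [Finset.mem_filter, Finset.mem_compl, hj, not_false_iff, true_and]
      split_ifs <;> omega

end IsGoodQuad

end BipartiteMap

/-! ### Urban renewal -/

namespace BipartiteMap

variable {V E F : Type*} {G : BipartiteMap V E F} {f : F} {e : Fin 4 → E}

/-- Both sides are the product of `l` over the corners that lie in `K` or satisfy `u k = 0`. Thus
the weight of the legs used after the mutation, multiplied by that of all contracted legs, is the weight
of the new legs that would be used without contraction, multiplied by that of the old legs used in
the complementary state. -/
theorem prod_mul_prod_compl (K : Finset (Fin 4)) (l : Fin 4 → ℝ) {u : Fin 4 → ℕ}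
    (hu : ∀ k, u k ≤ 1) :
    (∏ k ∈ K, l k) * ∏ k ∈ Kᶜ with u k = 0, l k =
      (∏ k with u k = 0, l k) * ∏ k ∈ K with 1 - u k = 0, l k := by
  rw [← Finset.univ_inter K, ← Finset.prod_ite_mem, Finset.univ_inter, Finset.prod_filter,
    ← Finset.univ_inter Kᶜ, ← Finset.prod_ite_mem, Finset.prod_filter, Finset.prod_filter,
    ← Finset.univ_inter K, ← Finset.prod_ite_mem, Finset.univ_inter, ← Finset.prod_mul_distrib,
    ← Finset.prod_mul_distrib]
  refine Finset.prod_congr rfl fun k _ => ?_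
  have := hu k
  obtain h | h : u k = 0 ∨ u k = 1 := by omega
  · by_cases hk : k ∈ K <;> simp [h, hk]
  · by_cases hk : k ∈ K <;> simp [h, hk]

namespace IsGoodQuad

variable [Fintype E]

theorem mem_outerEdges_of_notMem_edgeNbhd (h : G.IsGoodQuad f e) {x : E} (hx : x ∈ G.edges)
    (hx' : x ∉ G.edgeNbhd f e) : x ∈ G.outerEdges e := by
  refine mem_outerEdges.2 ⟨hx, ?_, ?_⟩
  · rintro k rfl
    refine hx' ⟨hx, ?_, ?_⟩
    · rw [h.left_edge]
      split_ifs
      exacts [.inl rfl, .inr ⟨k, rfl⟩]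
    · rw [h.right_edge]
      split_ifs
      exacts [.inr ⟨k, rfl⟩, .inl rfl]
  · rintro k hk rfl
    obtain ⟨hl, hr⟩ := h.faces_leg (mem_contracted.1 hk)
    refine hx' ⟨hx, .inr ?_, .inr ?_⟩
    · rw [hl]
      split_ifs
      exacts [⟨k, rfl⟩, ⟨k + 1, rfl⟩]
    · rw [hr]
      split_ifs
      exacts [⟨k + 1, rfl⟩, ⟨k, rfl⟩]

/-- The edge weights `ω` on `G` and `ω'` on its mutation differ by the urban renewal of a square
with weights `d`, in which the legs of the corners have the weights `l`. -/
structure IsRenewal (G : BipartiteMap V E F) (e : Fin 4 → E) (ω : E → ℝ) (ω' : E ⊕ Fin 4 → ℝ)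
    (l d d' : Fin 4 → ℝ) (D : ℝ) : Prop where
  outer : ∀ x ∈ G.outerEdges e, ω' (Sum.inl x) = ω x
  square : ∀ k, ω (e k) = d k
  square' : ∀ k, ω' (Sum.inl (e k)) = d' k
  leg : ∀ k ∈ G.contracted e, ω (G.leg e k) = l k
  leg' : ∀ k ∉ G.contracted e, ω' (Sum.inr k) = l k
  leg_ne : ∀ k, l k ≠ 0
  det : D = d 0 * d 2 + d 1 * d 3
  det_ne : D ≠ 0
  square_eq : ∀ k, d' (k + 2) * D = l (k + 1) * l (k + 2) * d k

open Classical in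
/-- Urban renewal multiplies the weighted number of perfect matchings that satisfy some condition on
the outer edges by a constant. -/
theorem sum_perfectMatchings_mutation (h : G.IsGoodQuad f e) {ω : E → ℝ} {ω' : E ⊕ Fin 4 → ℝ}
    {l d d' : Fin 4 → ℝ} {D : ℝ} (hr : IsRenewal G e ω ω' l d d' D)
    {Q : Finset E → Prop} {Ext : Finset E → Prop} {Ext' : Finset (E ⊕ Fin 4) → Prop}
    (hE : ∀ A P L, A ⊆ G.outerEdges e → L ⊆ G.contracted e →
      (Ext (glueEdges id e (G.leg e) A P L) ↔ Q A))
    (hE' : ∀ A P L, A ⊆ G.outerEdges e → L ⊆ (G.contracted e)ᶜ →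
      (Ext' (glueEdges Sum.inl (fun k => Sum.inl (e k)) Sum.inr A P L) ↔ Q A)) :
    ∑ M : Finset (E ⊕ Fin 4) with (G.mutation e).IsPerfectMatching M ∧ Ext' M, ∏ x ∈ M, ω' x =
      ((∏ k, l k) / D / ∏ k ∈ G.contracted e, l k) *
        ∑ M : Finset E with G.IsPerfectMatching M ∧ Ext M, ∏ x ∈ M, ω x := by
  have hK : ∏ k ∈ G.contracted e, l k ≠ 0 := Finset.prod_ne_zero_iff.2 fun k _ => hr.leg_ne k
  rw [h.isSplitting.sum_matchings (fun M hM x hx => (h.mem_edges_iff x).1 (hM.1 x hx))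
      h.isPerfectMatching_glueEdges hE,
    h.isSplitting_mutation.sum_matchings
      (fun M hM x hx => (h.mem_mutation_edges_iff x).1 (hM.1 x hx))
      h.mutation_isPerfectMatching_glueEdges hE', Finset.mul_sum]
  refine Finset.sum_congr rfl fun A hA => ?_
  have hA := Finset.mem_powerset.1 (Finset.mem_filter.1 hA).1
  rw [Finset.prod_congr rfl fun x hx => hr.outer x (hA hx)]
  rw [mul_left_comm]
  congr 1
  set g : (Fin 4 → ℕ) → ℝ := fun u =>
    if G.IsCompatible e A u then ∏ k ∈ G.contracted e with u k = 0, l k else 0 with hg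
  have h1 : ∑ P : Finset (Fin 4) with (∀ k, coverage P k ≤ 1) ∧ G.IsCompatible e A (coverage P),
      (∏ k ∈ P, ω (e k)) * ∏ k ∈ G.contracted e with coverage P k = 0, ω (G.leg e k) =
      ∑ P : Finset (Fin 4) with ∀ k, coverage P k ≤ 1, (∏ k ∈ P, d k) * g (coverage P) := by
    rw [← Finset.filter_filter, Finset.sum_filter]
    refine Finset.sum_congr (Finset.filter_congr_decidable ..) fun P hP => ?_
    simp only [hg]
    split_ifs with hc
    · congr 1
      · exact Finset.prod_congr rfl fun k _ => hr.square k
      · exact Finset.prod_congr rfl fun k hk => hr.leg k (Finset.mem_filter.1 hk).1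
    · rw [mul_zero]
  have h2 : (∏ k ∈ G.contracted e, l k) * ∑ P : Finset (Fin 4) with
        (∀ k, coverage P k ≤ 1) ∧ G.IsCompatible e A (fun k => 1 - coverage P k),
      (∏ k ∈ P, ω' (Sum.inl (e k))) *
        ∏ k ∈ (G.contracted e)ᶜ with coverage P k = 0, ω' (Sum.inr k) =
      ∑ P : Finset (Fin 4) with ∀ k, coverage P k ≤ 1,
        (∏ k ∈ P, d' k) * (∏ k with coverage P k = 0, l k) * g fun k => 1 - coverage P k := by
    rw [Finset.mul_sum, ← Finset.filter_filter, Finset.sum_filter]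
    refine Finset.sum_congr (Finset.filter_congr_decidable ..) fun P hP => ?_
    simp only [hg]
    split_ifs with hc
    · rw [mul_assoc, ← prod_mul_prod_compl _ _ (Finset.mem_filter.1 hP).2,
        mul_left_comm]
      congr 1
      · exact Finset.prod_congr rfl fun k _ => hr.square' k
      · congr 1
        exact Finset.prod_congr rfl fun k hk =>
          hr.leg' k (Finset.mem_compl.1 (Finset.mem_filter.1 hk).1)
    · rw [mul_zero]
  apply mul_left_cancel₀ hK
  rw [h2, h1, ← local_urban_renewal hr.det hr.det_ne hr.square_eq g]
  field_simp

theorem relatedByUrbanRenewal (h : G.IsGoodQuad f e) {ω : E → ℝ} {ω' : E ⊕ Fin 4 → ℝ}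
    {l d d' : Fin 4 → ℝ} {D : ℝ} (hr : IsRenewal G e ω ω' l d d' D) :
    G.RelatedByUrbanRenewal f e ω ω' := by
  classical
  refine ⟨fun x hx hx' => (hr.outer x (h.mem_outerEdges_of_notMem_edgeNbhd hx hx')).symm,
    fun M₀ _ => ?_⟩
  have hκ : (∏ k, l k) / D / ∏ k ∈ G.contracted e, l k ≠ 0 :=
    div_ne_zero (div_ne_zero (Finset.prod_ne_zero_iff.2 fun k _ => hr.leg_ne k) hr.det_ne)
      (Finset.prod_ne_zero_iff.2 fun k _ => hr.leg_ne k)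
  have hZ := h.sum_perfectMatchings_mutation hr (Q := fun _ => True) (Ext := fun _ => True)
    (Ext' := fun _ => True) (fun _ _ _ _ _ => Iff.rfl) (fun _ _ _ _ _ => Iff.rfl)
  have hN := h.sum_perfectMatchings_mutation hr
    (Q := fun A => ∀ x ∈ G.edges, x ∉ G.edgeNbhd f e → (x ∈ A ↔ x ∈ M₀))
    (Ext := fun A => ∀ x ∈ G.edges, x ∉ G.edgeNbhd f e → (x ∈ A ↔ x ∈ M₀))
    (Ext' := fun A => ∀ x ∈ G.edges, x ∉ G.edgeNbhd f e → (Sum.inl x ∈ A ↔ x ∈ M₀))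
    (fun A P L _ hL => forall₃_congr fun x hx hx' => iff_congr
      (h.isSplitting.outer_mem_glueEdges hL (h.mem_outerEdges_of_notMem_edgeNbhd hx hx')) Iff.rfl)
    (fun A P L _ hL => forall₃_congr fun x hx hx' => iff_congr
      (h.isSplitting_mutation.outer_mem_glueEdges hL
        (h.mem_outerEdges_of_notMem_edgeNbhd hx hx')) Iff.rfl)
  simp only [and_true] at hZ
  simp only [dimerProb, partitionFunction]
  rw [← Finset.sum_div, ← Finset.sum_div]
  convert (mul_div_mul_left _ _ hκ).symm using 2
  convert hN

end IsGoodQuad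

end BipartiteMap

/-! ### Circles of the Riemann sphere and star-ratios -/

theorem IsCircle.cases {C : Set (OnePoint ℂ)} {c : OnePoint ℂ} (h : IsCircle C c) :
    (∃ (m : ℂ) (r : ℝ), 0 < r ∧ C = (fun p : ℂ => (p : OnePoint ℂ)) '' Metric.sphere m r ∧ c = m) ∨
      ∃ p d : ℂ, d ≠ 0 ∧
        C = insert ∞ ((fun p : ℂ => (p : OnePoint ℂ)) '' Set.range fun t : ℝ => p + t * d) ∧
        c = ∞ := by
  cases h with
  | circle m r hr => exact .inl ⟨m, r, hr, rfl, rfl⟩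
  | line p d hd => exact .inr ⟨p, d, hd, by rw [← Set.range_comp]; rfl, rfl⟩

theorem IsCircle.exists_radius {C : Set (OnePoint ℂ)} {m : ℂ} (h : IsCircle C m) :
    ∃ r : ℝ, 0 < r ∧ C = (fun p : ℂ => (p : OnePoint ℂ)) '' Metric.sphere m r := by
  rcases h.cases with ⟨m', r, hr, hC, hm⟩ | ⟨p, d, _, _, hm⟩
  · rw [OnePoint.coe_injective hm]
    exact ⟨r, hr, hC⟩
  · exact absurd hm (OnePoint.coe_ne_infty m)

theorem image_coe_inter (A B : Set ℂ) : (fun p : ℂ => (p : OnePoint ℂ)) '' A ∩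
    (fun p : ℂ => (p : OnePoint ℂ)) '' B = (fun p : ℂ => (p : OnePoint ℂ)) '' (A ∩ B) :=
  (Set.image_inter OnePoint.coe_injective).symm

theorem finiteDiff_infty_left (q : OnePoint ℂ) : finiteDiff ∞ q = 1 := by
  induction q using OnePoint.rec <;> rfl

/-- At a face with centre `∞` all factors of the star-ratio are infinite, so that it is `-1`, `0` or
`∞`. -/
theorem center_ne_infty {V E F : Type*} [Fintype E] {G : BipartiteMap V E F}
    {z : CircleDrawing V F} {S : Set F} (hS : IsKasteleynOn G z S) {g : F} (hg : g ∈ S) :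
    z.center g ≠ ∞ := by
  intro h
  obtain ⟨t, ht, hs⟩ := hS g hg
  simp only [starRatio, h, finiteDiff_infty_left, Finset.prod_const_one] at hs
  split_ifs at hs
  · exact OnePoint.infty_ne_coe _ hs
  · exact ht.ne (Complex.ofReal_injective (OnePoint.coe_injective hs))
  · have := OnePoint.coe_injective hs
    rw [div_one] at this
    have : (-1 : ℝ) = t := by
      apply Complex.ofReal_injective
      push_cast
      exact this
    linarith

theorem starRatio_quadrilateral {V E F : Type*} [Fintype E] {G : BipartiteMap V E F} {f : F}
    {e : Fin 4 → E} (h : G.IsGoodQuad f e) {y : F → OnePoint ℂ} {Y : F → ℂ}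
    (hY : ∀ g, y g = Y g) (hne : ∀ k, Y (G.nbr e k) ≠ Y f) :
    starRatio G y f =
      ((-((Y (G.nbr e 1) - Y f) * (Y (G.nbr e 3) - Y f) /
        ((Y (G.nbr e 0) - Y f) * (Y (G.nbr e 2) - Y f))) : ℂ) : OnePoint ℂ) := by
  classical
  have h1 : (Finset.univ.filter fun x => x ∈ G.edges ∧ G.right x = f) = {e 1, e 3} := by
    ext x
    simp only [Finset.mem_filter, Finset.mem_univ, true_and, Finset.mem_insert,
      Finset.mem_singleton]
    constructor
    · rintro ⟨hx, hx'⟩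
      exact (h.right_eq_iff hx).1 hx'
    · rintro (rfl | rfl)
      exacts [⟨h.quad.mem 1, h.right_one⟩, ⟨h.quad.mem 3, h.right_three⟩]
  have h2 : (Finset.univ.filter fun x => x ∈ G.edges ∧ G.left x = f) = {e 0, e 2} := by
    ext x
    simp only [Finset.mem_filter, Finset.mem_univ, true_and, Finset.mem_insert,
      Finset.mem_singleton]
    constructor
    · rintro ⟨hx, hx'⟩
      exact (h.left_eq_iff hx).1 hx'
    · rintro (rfl | rfl)
      exacts [⟨h.quad.mem 0, h.quad.left_zero⟩, ⟨h.quad.mem 2, h.left_two⟩]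
  have hfd : ∀ g g', finiteDiff (y g) (y g') = Y g' - Y g := fun g g' => by
    rw [hY, hY]; rfl
  have hinf : ∀ g, y g ≠ ∞ := fun g => by rw [hY]; exact OnePoint.coe_ne_infty _
  have h13 : e 1 ≠ e 3 := fun h0 => absurd (h.edge_injective h0) (by decide)
  have hn1 : G.left (e 1) = G.nbr e 1 := rfl
  have hn3 : G.left (e 3) = G.nbr e 3 := rfl
  have hn0 : G.right (e 0) = G.nbr e 0 := rfl
  have hn2 : G.right (e 2) = G.nbr e 2 := rfl
  have hden : (Y (G.nbr e 0) - Y f) * (Y (G.nbr e 2) - Y f) ≠ 0 :=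
    mul_ne_zero (sub_ne_zero.2 (hne 0)) (sub_ne_zero.2 (hne 2))
  simp only [starRatio, hfd, hinf, or_self, Finset.filter_false, Finset.card_empty,
    lt_self_iff_false, false_or, true_and, if_false]
  have p1 : ∏ x : E with x ∈ G.edges ∧ G.right x = f, (Y (G.left x) - Y f) =
      (Y (G.nbr e 1) - Y f) * (Y (G.nbr e 3) - Y f) := by
    rw [h1, Finset.prod_pair h13, hn1, hn3]
  have p2 : ∏ x : E with x ∈ G.edges ∧ G.left x = f, (Y (G.right x) - Y f) =
      (Y (G.nbr e 0) - Y f) * (Y (G.nbr e 2) - Y f) := by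
    rw [h2, Finset.prod_pair h.quad.zero_ne_two, hn0, hn2]
  rw [if_neg]
  · congr 4
  · intro h0
    exact hden (p2.symm.trans (by convert h0))

/-! ### The Miquel move -/

namespace IsMiquelConfig

variable {V E F : Type*} {G : BipartiteMap V E F} {f : F} {e : Fin 4 → E}
  {z : CircleDrawing V F} {t ρ : ℝ} {m : ℂ} {r : Fin 4 → ℝ} {y v : Fin 4 → ℂ}

theorem exists_isMiquelMove (h : IsMiquelConfig t ρ m r y v)
    (hcirc : ∀ k, z.circ (G.nbr e k) = (fun p : ℂ => (p : OnePoint ℂ)) '' Metric.sphere (y k) (r k))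
    (hpos : ∀ k, z.pos (G.corner e k) = v k) :
    ∃ z' : CircleDrawing (V ⊕ Fin 4) F, IsMiquelMove G f e z z' := by
  classical
  refine ⟨⟨Sum.elim z.pos fun k => secondPoint y v k,
    Function.update z.circ f ((fun p : ℂ => (p : OnePoint ℂ)) ''
      Metric.sphere (mutatedCenter t m y) ‖secondPoint y v 0 - mutatedCenter t m y‖),
    Function.update z.center f (mutatedCenter t m y)⟩, ?_⟩
  constructor
  · exact fun _ => rfl
  · exact fun g hg => Function.update_of_ne hg _ _
  · exact fun g hg => Function.update_of_ne hg _ _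
  · simp only [Function.update_self]
    rcases (norm_nonneg (secondPoint y v 0 - mutatedCenter t m y)).eq_or_lt with h0 | h0
    · refine .inr ⟨_, ?_, rfl⟩
      rw [← h0, Metric.sphere_zero, Set.image_singleton]
    · exact .inl (.circle _ _ h0)
  · intro k
    rw [hcirc, hcirc, hpos, image_coe_inter, h.inter_old, Set.image_pair]
    rfl
  · intro k
    simp only [Function.update_self]
    rw [hcirc, image_coe_inter, h.inter_new, Set.image_pair]
    rfl

theorem center_eq_of_isMiquelMove (h : IsMiquelConfig t ρ m r y v)
    (hl : ¬ ∃ p d : ℂ, d ≠ 0 ∧ (∃ s : ℝ, m = p + s * d) ∧ ∀ k, ∃ s : ℝ, y k = p + s * d)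
    (hcirc : ∀ k, z.circ (G.nbr e k) = (fun p : ℂ => (p : OnePoint ℂ)) '' Metric.sphere (y k) (r k))
    (hpos : ∀ k, z.pos (G.corner e k) = v k)
    {z' : CircleDrawing (V ⊕ Fin 4) F} (hz' : IsMiquelMove G f e z z') :
    z'.center f = mutatedCenter t m y := by
  have hI : ∀ k, z'.pos (Sum.inr k) = secondPoint y v k := by
    intro k
    have := hz'.inter_old k
    rw [hcirc, hcirc, hpos, image_coe_inter, h.inter_old, Set.image_pair] at this
    rcases Set.pair_eq_pair_iff.1 this with h0 | h0
    · exact h0.2.symm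
    · exact h0.1.symm.trans h0.2.symm
  have hnew : ∀ k, z'.circ f ∩ (fun p : ℂ => (p : OnePoint ℂ)) ''
      Metric.sphere (y (k + 1)) (r (k + 1)) =
        (fun p : ℂ => (p : OnePoint ℂ)) '' {secondPoint y v k, secondPoint y v (k + 1)} := by
    intro k
    rw [← hcirc, hz'.inter_new, hI, hI, Set.image_pair]
  have hinj : Function.Injective (Set.image fun p : ℂ => (p : OnePoint ℂ)) :=
    Set.image_injective.2 OnePoint.coe_injective
  have hround : ∀ (n : ℂ) (R : ℝ),
      z'.circ f = (fun p : ℂ => (p : OnePoint ℂ)) '' Metric.sphere n R → z'.center f = n →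
        z'.center f = mutatedCenter t m y := by
    intro n R hC hc
    rw [hc, h.eq_mutatedCenter_of_inter hl (n := n) (R := R)]
    intro k
    apply hinj
    rw [← hnew k, hC]
    exact (image_coe_inter _ _).symm
  rcases hz'.new_circle with hc | ⟨p, hC, hc⟩
  · rcases hc.cases with ⟨n, R, _, hC, hc⟩ | ⟨p, d, hd, hC, _⟩
    · exact hround n R hC hc
    · refine (h.not_line_inter hl hd (p := p) fun k => ?_).elim
      apply hinj
      rw [← hnew k, hC, Set.insert_inter_of_notMem, image_coe_inter]
      rintro ⟨x, _, hx⟩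
      exact OnePoint.coe_ne_infty x hx
  · exact hround p 0 (by rw [Metric.sphere_zero, Set.image_singleton, hC]) hc

end IsMiquelConfig

/-- The circles of a quadrilateral and its neighbours in a circle pattern with finite centres. -/
theorem IsCirclePattern.exists_isMiquelConfig {V E F : Type*} [Fintype E]
    {G : BipartiteMap V E F} {z : CircleDrawing V F} (hz : IsCirclePattern G z) {f : F}
    {e : Fin 4 → E} (h : G.IsGoodQuad f e) {Y : F → ℂ} (hY : ∀ g, z.center g = Y g)
    (hsucc : ∀ k, Y (G.nbr e k) ≠ Y (G.nbr e (k + 1))) {t : ℝ} (ht : 0 < t)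
    (hs : starRatio G z.center f = ((t : ℂ) : OnePoint ℂ)) :
    ∃ (ρ : ℝ) (r : Fin 4 → ℝ) (v : Fin 4 → ℂ),
      IsMiquelConfig t ρ (Y f) r (fun k => Y (G.nbr e k)) v ∧
      (∀ k, z.circ (G.nbr e k) =
        (fun p : ℂ => (p : OnePoint ℂ)) '' Metric.sphere (Y (G.nbr e k)) (r k)) ∧
      ∀ k, z.pos (G.corner e k) = v k := by
  have hcirc : ∀ g, ∃ R : ℝ, 0 < R ∧
      z.circ g = (fun p : ℂ => (p : OnePoint ℂ)) '' Metric.sphere (Y g) R := fun g =>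
    IsCircle.exists_radius (hY g ▸ hz.isCircle g)
  choose R hR hcirc using hcirc
  have hne : ∀ k, Y (G.nbr e k) ≠ Y f := by
    intro k h0
    have := hz.center_ne _ (h.quad.mem k)
    rw [hY, hY, h.left_edge, h.right_edge] at this
    split_ifs at this
    · exact this (congrArg _ h0.symm)
    · exact this (congrArg _ h0)
  -- A corner is an end of two boundary edges and thus lies on three of the circles.
  have hc1 : ∀ k, G.endpt (BipartiteMap.cornerColor k) (e k) = G.corner e k := fun k => rfl
  have hc2 : ∀ k, G.endpt (BipartiteMap.cornerColor k) (e (k + 1)) = G.corner e k := fun k => by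
    rw [h.endpt_edge, BipartiteMap.cornerColor_add_one, if_neg (by simp), add_sub_cancel_right]
  have hon : ∀ (j k : Fin 4), G.endpt (BipartiteMap.cornerColor k) (e j) = G.corner e k →
      z.pos (G.corner e k) ∈ z.circ f ∧ z.pos (G.corner e k) ∈ z.circ (G.nbr e j) := by
    intro j k hjk
    have hl := hz.pos_mem_left (e j) (h.quad.mem j) (BipartiteMap.cornerColor k)
    have hr := hz.pos_mem_right (e j) (h.quad.mem j) (BipartiteMap.cornerColor k)
    rw [hjk, h.left_edge] at hl
    rw [hjk, h.right_edge] at hr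
    split_ifs at hl hr
    exacts [⟨hl, hr⟩, ⟨hr, hl⟩]
  have hv : ∀ k, ∃ v : ℂ, z.pos (G.corner e k) = v := fun k => by
    have := (hon k k (hc1 k)).1
    rw [hcirc] at this
    obtain ⟨v, _, hv⟩ := this
    exact ⟨v, hv.symm⟩
  choose v hv using hv
  have hmem : ∀ k g, z.pos (G.corner e k) ∈ z.circ g → v k ∈ Metric.sphere (Y g) (R g) := by
    intro k g hg
    rw [hcirc, hv] at hg
    obtain ⟨w, hw, hwv⟩ := hg
    rwa [← OnePoint.coe_injective hwv]
  refine ⟨R f, fun k => R (G.nbr e k), v, ?_, fun k => hcirc _, hv⟩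
  constructor
  · exact ht
  · rw [starRatio_quadrilateral h hY hne] at hs
    have hs := OnePoint.coe_injective hs
    have h0 := sub_ne_zero.2 (hne 0)
    have h2 := sub_ne_zero.2 (hne 2)
    rw [← hs]
    field_simp
  · exact fun k => hR _
  · exact hne
  · exact hsucc
  · intro k h0
    have hp := hz.pos_ne (e (k + 1)) (h.quad.mem _)
    have hcc := BipartiteMap.cornerColor_add_one k
    have e1 := hc1 (k + 1)
    have e2 := hc2 k
    rw [hcc] at e1
    cases hk : BipartiteMap.cornerColor k <;> rw [hk] at e1 e2 <;>
      simp only [Bool.not_false, Bool.not_true] at e1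
    · rw [e1, e2, hv, hv, h0] at hp
      exact hp rfl
    · rw [e1, e2, hv, hv, h0] at hp
      exact hp rfl
  · exact fun k => hmem k f (hon k k (hc1 k)).1
  · exact fun k => hmem k _ (hon k k (hc1 k)).2
  · exact fun k => hmem k _ (hon (k + 1) k (hc2 k)).2

/-! ### Circle patterns and urban renewal -/

namespace BipartiteMap.IsGoodQuad

variable {V E F : Type*} {G : BipartiteMap V E F} {f : F} {e : Fin 4 → E}

theorem centerDistance_eq {V' : Type*} {z : CircleDrawing V' F} {Y : F → ℂ}
    (hY : ∀ g, z.center g = Y g) (x : E) :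
    centerDistance G z x = ‖Y (G.left x) - Y (G.right x)‖ := by
  rw [centerDistance, hY, hY]; rfl

variable [Fintype E]

theorem left_ne_of_outer (h : G.IsGoodQuad f e) {x : E} (hx : x ∈ G.outerEdges e) :
    G.left x ≠ f ∧ G.right x ≠ f := by
  obtain ⟨hx1, hx2, _⟩ := mem_outerEdges.1 hx
  constructor
  · intro h0
    rcases (h.left_eq_iff hx1).1 h0 with h0 | h0 <;> exact hx2 _ h0
  · intro h0
    rcases (h.right_eq_iff hx1).1 h0 with h0 | h0 <;> exact hx2 _ h0

/-- The distances of the circle centres before and after the Miquel move satisfy the rule of urban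
renewal. -/
theorem isRenewal (h : G.IsGoodQuad f e) {z : CircleDrawing V F} {Y : F → ℂ}
    (hY : ∀ g, z.center g = Y g) {t ρ : ℝ} {r : Fin 4 → ℝ} {v : Fin 4 → ℂ}
    (hM : IsMiquelConfig t ρ (Y f) r (fun k => Y (G.nbr e k)) v)
    {z' : CircleDrawing (V ⊕ Fin 4) F} (hz' : ∀ g, g ≠ f → z'.center g = z.center g)
    (hf' : z'.center f = mutatedCenter t (Y f) fun k => Y (G.nbr e k)) :
    IsRenewal G e (centerDistance G z) (centerDistance (G.mutation e) z')
      (fun k => ‖Y (G.nbr e k) - Y (G.nbr e (k + 1))‖) (fun k => ‖Y (G.nbr e k) - Y f‖)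
      (fun k => ‖Y (G.nbr e k) - mutatedCenter t (Y f) fun k => Y (G.nbr e k)‖)
      (‖Y (G.nbr e 0) - Y f‖ * ‖Y (G.nbr e 2) - Y f‖ +
        ‖Y (G.nbr e 1) - Y f‖ * ‖Y (G.nbr e 3) - Y f‖) := by
  have hd : ∀ k, 0 < ‖Y (G.nbr e k) - Y f‖ := fun k =>
    norm_pos_iff.2 (sub_ne_zero.2 (hM.ne_center k))
  have hnbr : ∀ k, z'.center (G.nbr e k) = Y (G.nbr e k) := fun k => by
    rw [hz' _ (h.nbr_ne k), hY]
  constructor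
  · intro x hx
    have hb := (mem_outerEdges.1 hx).2.1
    have hl : (G.mutation e).left (Sum.inl x) = G.left x := by
      simp only [mutation, Sum.elim_inl]
      exact onBoundary_of_ne hb _ _
    have hr : (G.mutation e).right (Sum.inl x) = G.right x := by
      simp only [mutation, Sum.elim_inl]
      exact onBoundary_of_ne hb _ _
    obtain ⟨h1, h2⟩ := h.left_ne_of_outer hx
    rw [centerDistance, centerDistance, hl, hr, hz' _ h1, hz' _ h2]
  · intro k
    rw [centerDistance_eq hY, h.left_edge, h.right_edge]
    split_ifs
    · exact norm_sub_rev _ _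
    · rfl
  · intro k
    have hl : (G.mutation e).left (Sum.inl (e k)) = G.right (e k) := by
      simp only [mutation, Sum.elim_inl]
      exact onBoundary_edge h.edge_injective _ _ k
    have hr : (G.mutation e).right (Sum.inl (e k)) = G.left (e k) := by
      simp only [mutation, Sum.elim_inl]
      exact onBoundary_edge h.edge_injective _ _ k
    rw [centerDistance, hl, hr, h.left_edge, h.right_edge]
    split_ifs
    · rw [hnbr, hf']; rfl
    · rw [hnbr, hf']; exact norm_sub_rev _ _
  · intro k hk
    obtain ⟨hl, hr⟩ := h.faces_leg (mem_contracted.1 hk)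
    rw [centerDistance_eq hY, hl, hr]
    split_ifs
    · rfl
    · exact norm_sub_rev _ _
  · intro k _
    have hl : (G.mutation e).left (Sum.inr k) =
      if cornerColor k then G.nbr e (k + 1) else G.nbr e k := rfl
    have hr : (G.mutation e).right (Sum.inr k) =
      if cornerColor k then G.nbr e k else G.nbr e (k + 1) := rfl
    rw [centerDistance, hl, hr]
    split_ifs
    · rw [hnbr, hnbr]; exact norm_sub_rev _ _
    · rw [hnbr, hnbr]; rfl
  · exact fun k => norm_ne_zero_iff.2 (sub_ne_zero.2 (hM.ne_succ k))
  · rfl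
  · exact (add_pos (mul_pos (hd 0) (hd 2)) (mul_pos (hd 1) (hd 3))).ne'
  · intro k
    have e1 : k + 1 + 1 = k + 2 := by revert k; decide
    have e2 : k + 2 + 1 = k + 3 := by revert k; decide
    simp only [e1, e2]
    exact hM.norm_mutatedCenter_add_two k

end BipartiteMap.IsGoodQuad

theorem theorem2 {V E F : Type*} [Fintype E]
    (G : BipartiteMap V E F) (hG : G.IsSurfaceGraph)
    (z : CircleDrawing V F) (hz : IsCirclePattern G z)
    (f : F) (e : Fin 4 → E) (hf : IsValidFace G z.center f e)
    (S : Set F) (hfS : f ∈ S) (hS : IsKasteleynOn G z S) (hfin : ∀ g, g ∉ S → z.center g ≠ OnePoint.infty)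
    (hline : ¬ ∃ L, IsCircle L OnePoint.infty ∧ z.center f ∈ L ∧ ∀ k, z.center (G.nbr e k) ∈ L) :
    (∃ z' : CircleDrawing (V ⊕ Fin 4) F, IsMiquelMove G f e z z') ∧
    ∀ z' : CircleDrawing (V ⊕ Fin 4) F, IsMiquelMove G f e z z' →
      (∀ x ∈ G.edges, 0 < centerDistance G z x) ∧
      (∀ x ∈ (G.mutation e).edges, 0 < centerDistance (G.mutation e) z' x) ∧
      G.RelatedByUrbanRenewal f e (centerDistance G z) (centerDistance (G.mutation e) z') := by
  have hfinite : ∀ g, ∃ c : ℂ, z.center g = c := by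
    intro g
    have : z.center g ≠ ∞ := by
      by_cases hg : g ∈ S
      · exact center_ne_infty hS hg
      · exact hfin g hg
    obtain ⟨c, hc⟩ := OnePoint.ne_infty_iff_exists.1 this
    exact ⟨c, hc.symm⟩
  choose Y hY using hfinite
  have h : G.IsGoodQuad f e :=
    ⟨hG, hf.quad, fun x hx h0 => hz.center_ne x hx (congrArg _ h0), hf.nbr_injective⟩
  have hsucc : ∀ k, Y (G.nbr e k) ≠ Y (G.nbr e (k + 1)) := fun k h0 =>
    hf.ne_succ k (by rw [hY, hY, h0])
  obtain ⟨t, ht, hs⟩ := hS f hfS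
  obtain ⟨ρ, r, v, hM, hcirc, hpos⟩ := hz.exists_isMiquelConfig h hY hsucc ht hs
  have hl : ¬ ∃ p d : ℂ, d ≠ 0 ∧ (∃ s : ℝ, Y f = p + s * d) ∧
      ∀ k, ∃ s : ℝ, Y (G.nbr e k) = p + s * d := by
    rintro ⟨p, d, hd, ⟨s, hs⟩, hk⟩
    refine hline ⟨_, .line p d hd, .inr ⟨s, ?_⟩, fun k => .inr ?_⟩
    · rw [hY, hs]
    · obtain ⟨s, hs⟩ := hk k
      exact ⟨s, by rw [hY, hs]⟩
  refine ⟨hM.exists_isMiquelMove hcirc hpos, fun z' hz' => ?_⟩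
  have hr := h.isRenewal hY hM hz'.center_old (hM.center_eq_of_isMiquelMove hl hcirc hpos hz')
  have hpos' : ∀ x ∈ G.edges, 0 < centerDistance G z x := by
    intro x hx
    rw [BipartiteMap.IsGoodQuad.centerDistance_eq hY]
    refine norm_pos_iff.2 (sub_ne_zero.2 fun h0 => hz.center_ne x hx ?_)
    rw [hY, hY, h0]
  refine ⟨hpos', fun x hx => ?_, h.relatedByUrbanRenewal hr⟩
  rw [h.mem_mutation_edges_iff] at hx
  rcases hx with ⟨x, hx, rfl⟩ | ⟨k, rfl⟩ | ⟨k, hk, rfl⟩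
  · rw [hr.outer x hx]
    exact hpos' x (BipartiteMap.mem_outerEdges.1 hx).1
  · rw [hr.square']
    exact norm_pos_iff.2 (sub_ne_zero.2 (hM.ne_mutatedCenter k))
  · rw [hr.leg' k (Finset.mem_compl.1 hk)]
    exact norm_pos_iff.2 (sub_ne_zero.2 (hM.ne_succ k))
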